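/- **Setting.** Matrices carry the Frobenius norm $\|\cdot\|$. Let $d\ge 1$. $\mathrm{Gr}_{d,n}\subseteq\mathbb R^{n\times n}$ is the set of matrices $A=A^t=A^2$ of rank $d$; $\mathbb R^{\infty\times\infty}=\bigcup_n\mathbb R^{n\times n}$ and $\mathrm{Gr}_d=\bigcup_n\mathrm{Gr}_{d,n}$ carry the direct limit topologies. $\mathrm{Gr}_d^{\delta}$ is $\mathrm{Gr}_d$ if $\delta=0$, and the set of $A\in\mathbb R^{\infty\times\infty}$ at distance $<\delta$ from some point of $\mathrm{Gr}_d$ if $\delta>0$, with the topology inherited from $\mathbb R^{\infty\times\infty}$. $[X,Y]$ is the set of homotopy classes of continuous maps $X\to Y$. Let $B$ be a paracompact normal space (for instance a paracompact Hausdorff space) and $\mathcal U=\{U_i\}_{i\in I}$ a countable open cover of $B$. A *cochain* $\Omega$ on $\mathcal U$ is a family of continuous maps $\Omega_{ij}:U_j\cap U_i\to O(d)$ (for $i,j\in I$ with $U_j\cap U_i\ne\emptyset$) with $\Omega_{ij}=\Omega_{ji}^{-1}$. It is an *exact cocycle* (or $0$-approximate cocycle) if $\Omega_{ij}(y)\Omega_{jk}(y)=\Omega_{ik}(y)$,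 and for $\varepsilon>0$ an *$\varepsilon$-approximate cocycle* if $\|\Omega_{ij}(y)\Omega_{jk}(y)-\Omega_{ik}(y)\|<\varepsilon$, for all $i,j,k$ and all $y\in U_k\cap U_j\cap U_i$. Put $$d_Z(\Omega,\Lambda)=\sup_{i,j}\ \sup_{y\in U_j\cap U_i}\|\Omega_{ij}(y)-\Lambda_{ij}(y)\|.$$ For a partition of unity $\varphi$ subordinate to $\mathcal U$ and an injection $\iota:I\to\mathbb N$ (with $0\in\mathbb N$, rows being numbered from $0$), let $\Phi_i(y)$, for $y\in U_i$, be the matrix with $d$ columns and infinitely many rows whose rows $d\,\iota(j),\dots,d\,\iota(j)+d-1$ form the block $\sqrt{\varphi_j(y)}\,\Omega_{ij}(y)^t$ for each $j\in I$ (read as $0$ if $y\notin U_j$), all other rows being $0$. Let $\mathsf{av}_{\varphi,\iota}(\Omega)(y)=\sum_i\varphi_i(y)\,\Phi_i(y)\Phi_i(y)^t$. If $\Omega$ is an $\varepsilon$-approximate cocycle, $\mathsf{cl}(\Omega)\in[B,\mathrm{Gr}_d^{\sqrt2\varepsilon}]$ denotes the class of the map $\mathsf{av}_{\varphi,\iota}(\Omega):B\to\mathrm{Gr}_d^{\sqrt2\varepsilon}$,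 which is continuous and whose class does not depend on $\varphi$ and $\iota$ (this is part of the claim). **Theorem.** Let $0\le\varepsilon\le\sqrt2/4$ and let $\Omega$ be an $\varepsilon$-approximate cocycle on $\mathcal U$. Then every point of $\mathrm{Gr}_d^{\sqrt2\varepsilon}$ has a unique closest point in $\mathrm{Gr}_d$, the resulting map $\pi:\mathrm{Gr}_d^{\sqrt2\varepsilon}\to\mathrm{Gr}_d$ is continuous, the class $\mathsf{cl}(\Omega)$ is well defined, and there is an exact cocycle $\Lambda$ on $\mathcal U$, with well-defined class $\mathsf{cl}(\Lambda)\in[B,\mathrm{Gr}_d]$, such that $$\mathsf{cl}(\Lambda)=\pi_*(\mathsf{cl}(\Omega))\ \text{ in } [B,\mathrm{Gr}_d]\qquad\text{and}\qquad d_Z(\Omega,\Lambda)\le 9\varepsilon,$$ where $\pi_*$ is postcomposition with $\pi$. -/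

import Mathlib

open scoped Matrix ENNReal Topology

noncomputable section

namespace ApproxBundle

/-! ### Frobenius norm, infinite matrices, Grassmannians and their thickenings -/

/-- The Frobenius norm of a real matrix.  It is only used for finite matrices and for infinite
matrices with finitely many nonzero entries, so that the sum is a finite one. -/
def frobNorm {m n : Type*} (A : Matrix m n ℝ) : ℝ :=
  √(∑' p : m × n, A p.1 p.2 ^ 2)

/-- The space `ℝ^{∞×∞} = ⋃ₙ ℝ^{n×n}` of infinite matrices with finite support
(rows and columns are numbered from `0`). -/
structure InfMat where
  entries : Matrix ℕ ℕ ℝ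
  finite_support : ∃ n : ℕ, ∀ i j : ℕ, (n ≤ i ∨ n ≤ j) → entries i j = 0

/-- The inclusion `ℝ^{n×n} → ℝ^{∞×∞}`, padding by zeros at the bottom and on the right. -/
def InfMat.pad (n : ℕ) (A : Matrix (Fin n) (Fin n) ℝ) : InfMat where
  entries := fun i j => if h : i < n ∧ j < n then A ⟨i, h.1⟩ ⟨j, h.2⟩ else 0
  finite_support := ⟨n, fun i j hij => dif_neg (by omega)⟩

/-- The direct limit topology on `ℝ^{∞×∞}`: the finest topology for which all the inclusions
`ℝ^{n×n} → ℝ^{∞×∞}` are continuous. -/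
instance : TopologicalSpace InfMat :=
  ⨆ n : ℕ, TopologicalSpace.coinduced (InfMat.pad n) inferInstance

/-- The Frobenius distance on `ℝ^{∞×∞}`. -/
def InfMat.frobDist (A B : InfMat) : ℝ := frobNorm (A.entries - B.entries)

/-- The Grassmannian `Gr_{d,n}` of orthogonal projections of rank `d` in `ℝ^{n×n}`. -/
def grassmannian (d n : ℕ) : Set (Matrix (Fin n) (Fin n) ℝ) :=
  {A | Aᵀ = A ∧ A * A = A ∧ A.rank = d}

/-- The infinite Grassmannian `Gr_d = ⋃ₙ Gr_{d,n}`.  As each `Gr_{d,n}` is closed in `ℝ^{n×n}`,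
the topology of `Gr_d` as a subspace of `ℝ^{∞×∞}` is the direct limit of those of the `Gr_{d,n}`. -/
def Gr (d : ℕ) : Set InfMat := ⋃ n : ℕ, InfMat.pad n '' grassmannian d n

/-- The `δ`-thickening of `Gr_d` in `ℝ^{∞×∞}`, equal to `Gr_d` for `δ = 0`.  For `δ > 0` it is an
open subset of `ℝ^{∞×∞}`, with the (direct limit) topology inherited from there. -/
def thickGr (d : ℕ) (δ : ℝ) : Set InfMat :=
  {A | (δ = 0 ∧ A ∈ Gr d) ∨ (0 < δ ∧ ∃ P ∈ Gr d, A.frobDist P < δ)}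

/-- `π` is the projection of the thickening to `Gr_d`: every point `A` of the thickening has
exactly one closest point in `Gr_d`, namely `π A`. -/
def IsClosestPointProjection {d : ℕ} {δ : ℝ} (π : C(thickGr d δ, Gr d)) : Prop :=
  ∀ (A : thickGr d δ) (P : Gr d),
    (∀ Q : Gr d, A.1.frobDist P.1 ≤ A.1.frobDist Q.1) ↔ P = π A

/-! ### Homotopy classes of maps -/

/-- The set `[X, Y]` of homotopy classes of continuous maps `X → Y`. -/
def HomotopyClasses (X Y : Type*) [TopologicalSpace X] [TopologicalSpace Y] : Type _ :=
  Quotient (Setoid.mk (ContinuousMap.Homotopic (X := X) (Y := Y))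
    ContinuousMap.Homotopic.equivalence)

/-- The homotopy class of a continuous map. -/
def homotopyClass {X Y : Type*} [TopologicalSpace X] [TopologicalSpace Y] (f : C(X, Y)) :
    HomotopyClasses X Y :=
  Quotient.mk _ f

/-- The map `g_* : [X, Y] → [X, Z]` given by postcomposition with `g : Y → Z`. -/
def HomotopyClasses.postcomp {X Y Z : Type*} [TopologicalSpace X] [TopologicalSpace Y]
    [TopologicalSpace Z] (g : C(Y, Z)) : HomotopyClasses X Y → HomotopyClasses X Z :=
  Quotient.map (fun f => g.comp f)
    (fun _ _ h => ContinuousMap.Homotopic.comp (ContinuousMap.Homotopic.refl g) h)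

/-! ### Cochains and approximate cocycles with values in `O(d)` -/

variable {B I : Type*} [TopologicalSpace B]

/-- A `1`-cochain subordinate to `U` with values in `O(d)`: continuous maps
`Ω i j : U j ∩ U i → O(d)` with `Ω i j = (Ω j i)⁻¹`.  If `U j ∩ U i` is empty then `Ω i j` carries
no information, so this is the same as a family indexed by the ordered `1`-simplices of the
nerve. -/
structure Cochain (U : I → Set B) (d : ℕ) where
  map : ∀ i j : I, C(↥(U j ∩ U i), Matrix.orthogonalGroup (Fin d) ℝ)
  symm : ∀ (i j : I) (y : B) (hi : y ∈ U i) (hj : y ∈ U j),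
    map i j ⟨y, hj, hi⟩ = (map j i ⟨y, hi, hj⟩)⁻¹

variable {U : I → Set B} {d : ℕ}

open Classical in
/-- The matrix `Ω i j (y)`, with the value `0` for `y` outside of `U j ∩ U i`. -/
def Cochain.val (Ω : Cochain U d) (i j : I) (y : B) : Matrix (Fin d) (Fin d) ℝ :=
  if h : y ∈ U j ∩ U i then (Ω.map i j ⟨y, h⟩ : Matrix (Fin d) (Fin d) ℝ) else 0

/-- Exact cocycles: `Ω i j (y) * Ω j k (y) = Ω i k (y)` on all triple intersections. -/
def Cochain.IsExactCocycle (Ω : Cochain U d) : Prop :=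
  ∀ (i j k : I) (y : B), y ∈ U i → y ∈ U j → y ∈ U k →
    Ω.val i j y * Ω.val j k y = Ω.val i k y

/-- `ε`-approximate cocycles, with respect to the Frobenius distance on `O(d)`; the
`0`-approximate cocycles are the exact cocycles. -/
def Cochain.IsApproxCocycle (ε : ℝ) (Ω : Cochain U d) : Prop :=
  (ε = 0 ∧ Ω.IsExactCocycle) ∨
    (0 < ε ∧ ∀ (i j k : I) (y : B), y ∈ U i → y ∈ U j → y ∈ U k →
      frobNorm (Ω.val i j y * Ω.val j k y - Ω.val i k y) < ε)

/-- The distance `d_Z` between cochains: the supremum, over all `i`, `j` and all `y ∈ U j ∩ U i`,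
of the Frobenius distance between `Ω i j (y)` and `Λ i j (y)`. -/
def cochainDist (Ω Λ : Cochain U d) : ℝ≥0∞ :=
  ⨆ (i : I) (j : I) (y : B) (_ : y ∈ U j ∩ U i),
    ENNReal.ofReal (frobNorm (Ω.val i j y - Λ.val i j y))

/-! ### The classifying map of an approximate cocycle -/

/-- The local trivialization of a cochain `Ω` given by a partition of unity `φ` and an injection
`ι` of the index set into `ℕ`.  For `y ∈ U i` it is the frame (an infinite matrix with `d`
orthonormal columns) which consists of `d × d` blocks, the block with number `ι j`, in the rows
from `d * ι j` to `d * ι j + (d - 1)`, being `√(φ j (y)) * (Ω i j (y))ᵀ`, and which is `0` in all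
other rows. -/
def triv (φ : PartitionOfUnity I B) (ι : I ↪ ℕ) (Ω : Cochain U d) (i : I) (y : B) :
    Matrix ℕ (Fin d) ℝ :=
  fun r b => ∑ᶠ p : I × Fin d,
    if r = d * ι p.1 + (p.2 : ℕ) then √(φ p.1 y) * (Ω.val i p.1 y)ᵀ p.2 b else 0

/-- The average `∑ i, φ i (y) Φ i (y) (Φ i (y))ᵀ` of the projections given by a family of frames;
the sum is finite because a partition of unity is locally finite. -/
def av (φ : PartitionOfUnity I B) (Φ : I → B → Matrix ℕ (Fin d) ℝ) (y : B) : Matrix ℕ ℕ ℝ :=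
  ∑ᶠ i : I, φ i y • (Φ i y * (Φ i y)ᵀ)

/-- `IsCl X Ω c` says that the class `c ∈ [B, X]`, where `X` is `Gr_d` or one of its thickenings,
is the class `cl(Ω)`: for *every* partition of unity `φ` subordinate to the cover and *every*
injection `ι` of the index set into `ℕ`, the averaged map of the local trivialization of `Ω` is a
continuous map `B → X` with homotopy class `c`. -/
def IsCl (X : Set InfMat) (Ω : Cochain U d) (c : HomotopyClasses B X) : Prop :=
  ∀ (φ : PartitionOfUnity I B), φ.IsSubordinate U → ∀ ι : I ↪ ℕ,
    ∃ f : C(B, X), (∀ y : B, (f y).1.entries = av φ (triv φ ι Ω) y) ∧ homotopyClass f = c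

end ApproxBundle

end

/-! The local trivializations of `Ω` are orthonormal frames `Φ i` with `Φ i * Ω i j` within `ε` of
`Φ j`: the squared distance is the `φ`-weighted mean of the squared cocycle defects. Hence the
projections `P i = Φ i * (Φ i)ᵀ` differ by at most `√2 * ε` (`frobNorm_proj_sub_proj_le`), and by
convexity their average stays that close to each of them (`FrameSystem.near_av`).

A matrix at distance less than `1/2` from a rank `d` projection has, after symmetrization, exactly
`d` eigenvalues above `1/2`, and the corresponding spectral projection is its unique closest point
in `Gr d` (`exists_spectral_projection`, `exists_closest_point`). Continuity of `π` comes from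
uniqueness together with compactness of the finite Grassmannians. The bound `ε ≤ √2 / 4` says
precisely that `√2 * ε ≤ 1 / 2`.

Let `Q` be the projected average. It lies within `2 * √2 * ε` of every `P i`, strictly below `1`, so
`Q * Φ i` is injective and its polar part `Ψ i` is a frame of the range of `Q` with `‖Φ i - Ψ i‖ ≤
‖P i - Q‖` (`polar_frame`). As all `Ψ i` span the same space, `Λ i j = (Ψ i)ᵀ * Ψ j` is an exact
cocycle, and its distance from `Ω` is at most `ε + 2 * (2 * √2 * ε) ≤ 9 * ε`
(`frobNorm_sub_gram_le`).

The statements on classes rest on one principle (`FrameSystem.homotopic`): the class of an averaged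
map depends only on the transition functions. Two frame systems with the same transition functions
can be moved by rotations into disjoint sets of coordinates and then joined by `√(1 - t) Φ + √t Ψ`,
which has those transition functions for all `t`, with the same error bound. This makes `cl`
independent of all choices. It also identifies `cl(Λ)` with the class of `Q`, because the frames `Ψ
i` have transition functions `Λ` and average to `Q`.

The predicate `Near` treats `ε = 0` (equality) and `ε > 0` (strict inequality) together, in parallel
with the two cases of `thickGr`. -/

noncomputable section

namespace ApproxBundle

/-! ### Frobenius norm estimates for finite matrices -/

section Finite

variable {m n k : Type*} [Fintype m] [Fintype n] [Fintype k]

theorem frobNorm_nonneg {m n : Type*} (A : Matrix m n ℝ) : 0 ≤ frobNorm A := Real.sqrt_nonneg _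

theorem frobNorm_sq (A : Matrix m n ℝ) : frobNorm A ^ 2 = ∑ i, ∑ j, A i j ^ 2 := by
  rw [frobNorm, Real.sq_sqrt (tsum_nonneg fun _ => sq_nonneg _), tsum_fintype,
    Fintype.sum_prod_type]

theorem frobNorm_zero {m n : Type*} : frobNorm (0 : Matrix m n ℝ) = 0 := by
  simp [frobNorm]

theorem frobNorm_neg {m n : Type*} (A : Matrix m n ℝ) : frobNorm (-A) = frobNorm A := by
  simp [frobNorm]

theorem frobNorm_sub_comm {m n : Type*} (A B : Matrix m n ℝ) :
    frobNorm (A - B) = frobNorm (B - A) := by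
  rw [← neg_sub, frobNorm_neg]

theorem frobNorm_eq_zero {A : Matrix m n ℝ} (h : frobNorm A = 0) : A = 0 := by
  ext i j
  have h1 : A i j ^ 2 ≤ ∑ j, A i j ^ 2 :=
    Finset.single_le_sum (f := fun j => A i j ^ 2) (fun _ _ => sq_nonneg _) (Finset.mem_univ j)
  have h2 : ∑ j, A i j ^ 2 ≤ ∑ i, ∑ j, A i j ^ 2 :=
    Finset.single_le_sum (f := fun i => ∑ j, A i j ^ 2)
      (fun _ _ => Finset.sum_nonneg fun _ _ => sq_nonneg _) (Finset.mem_univ i)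
  rw [← frobNorm_sq, h] at h2
  have h3 : A i j ^ 2 = 0 := le_antisymm (by linarith) (sq_nonneg _)
  simpa using h3

theorem frobNorm_sq_eq_trace (A : Matrix m n ℝ) : frobNorm A ^ 2 = (Aᵀ * A).trace := by
  rw [frobNorm_sq, Finset.sum_comm]
  simp [Matrix.trace, Matrix.mul_apply, sq]

theorem frobNorm_le_of_sq_le {m n p q : Type*} {A : Matrix m n ℝ} {B : Matrix p q ℝ}
    (h : frobNorm A ^ 2 ≤ frobNorm B ^ 2) : frobNorm A ≤ frobNorm B :=
  (sq_le_sq₀ (frobNorm_nonneg _) (frobNorm_nonneg _)).1 h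

section

open scoped Matrix.Norms.Frobenius

theorem frobNorm_eq_norm (A : Matrix m n ℝ) : frobNorm A = ‖A‖ := by
  rw [Matrix.frobenius_norm_def, ← Real.sqrt_eq_rpow, ← Real.sqrt_sq (frobNorm_nonneg A),
    frobNorm_sq]
  simp

theorem frobNorm_add_le (A B : Matrix m n ℝ) : frobNorm (A + B) ≤ frobNorm A + frobNorm B := by
  simpa only [frobNorm_eq_norm] using norm_add_le A B

theorem frobNorm_smul (c : ℝ) (A : Matrix m n ℝ) : frobNorm (c • A) = |c| * frobNorm A := by
  rw [frobNorm_eq_norm, frobNorm_eq_norm, norm_smul, Real.norm_eq_abs]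

end

theorem frobNorm_sub_le (A B C : Matrix m n ℝ) :
    frobNorm (A - C) ≤ frobNorm (A - B) + frobNorm (B - C) := by
  simpa using frobNorm_add_le (A - B) (B - C)

theorem frobNorm_transpose (A : Matrix m n ℝ) : frobNorm Aᵀ = frobNorm A := by
  rw [← Real.sqrt_sq (frobNorm_nonneg Aᵀ), ← Real.sqrt_sq (frobNorm_nonneg A), frobNorm_sq,
    frobNorm_sq, Finset.sum_comm]
  rfl

theorem dotProduct_self_nonneg (x : n → ℝ) : 0 ≤ x ⬝ᵥ x :=
  Finset.sum_nonneg fun _ _ => mul_self_nonneg _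

theorem dotProduct_self_pos {x : n → ℝ} (hx : x ≠ 0) : 0 < x ⬝ᵥ x :=
  lt_of_le_of_ne (dotProduct_self_nonneg x) fun h => hx (dotProduct_self_eq_zero.1 h.symm)

theorem mulVec_dotProduct_self_le (A : Matrix m n ℝ) (x : n → ℝ) :
    (A *ᵥ x) ⬝ᵥ (A *ᵥ x) ≤ frobNorm A ^ 2 * (x ⬝ᵥ x) := by
  rw [frobNorm_sq, dotProduct, Finset.sum_mul]
  refine Finset.sum_le_sum fun i _ => ?_
  have := Finset.sum_mul_sq_le_sq_mul_sq Finset.univ (A i) x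
  simpa [Matrix.mulVec, dotProduct, sq] using this

theorem abs_dotProduct_mulVec_le (A : Matrix n n ℝ) (x : n → ℝ) :
    |x ⬝ᵥ A *ᵥ x| ≤ frobNorm A * (x ⬝ᵥ x) := by
  apply abs_le_of_sq_le_sq _ (mul_nonneg (frobNorm_nonneg _) (dotProduct_self_nonneg _))
  have h1 := Finset.sum_mul_sq_le_sq_mul_sq Finset.univ x (A *ᵥ x)
  have h2 := mulVec_dotProduct_self_le A x
  have h3 := dotProduct_self_nonneg x
  have h4 : (∑ i, x i ^ 2) = x ⬝ᵥ x := by simp [dotProduct, sq]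
  have h5 : (∑ i, (A *ᵥ x) i ^ 2) = (A *ᵥ x) ⬝ᵥ (A *ᵥ x) := by simp [dotProduct, sq]
  rw [h4, h5] at h1
  calc (x ⬝ᵥ A *ᵥ x) ^ 2 ≤ (x ⬝ᵥ x) * ((A *ᵥ x) ⬝ᵥ (A *ᵥ x)) := h1
    _ ≤ (x ⬝ᵥ x) * (frobNorm A ^ 2 * (x ⬝ᵥ x)) := by gcongr
    _ = _ := by ring

/-- Dimension count: restricted to the vectors supported on `T`, `N` maps into a space of smaller
dimension. This plays the role of the min-max principle when eigenvalues are counted below. -/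
theorem exists_mulVec_eq_zero_of_rank_lt {N : Matrix n n ℝ} {T : Finset n} (h : N.rank < T.card) :
    ∃ z : n → ℝ, z ≠ 0 ∧ (∀ i ∉ T, z i = 0) ∧ N *ᵥ z = 0 := by
  let f : (T → ℝ) →ₗ[ℝ] LinearMap.range N.mulVecLin :=
    N.mulVecLin.rangeRestrict ∘ₗ Function.ExtendByZero.linearMap ℝ (Subtype.val : T → n)
  have hf : LinearMap.ker f ≠ ⊥ := by
    apply LinearMap.ker_ne_bot_of_finrank_lt
    simpa [Matrix.rank] using h
  obtain ⟨w, hw, hw0⟩ := Submodule.exists_mem_ne_zero_of_ne_bot hf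
  refine ⟨Function.extend Subtype.val w 0, ?_, ?_, ?_⟩
  · intro h0
    apply hw0
    ext i
    have := congrFun h0 i.1
    rwa [Subtype.val_injective.extend_apply] at this
  · intro i hi
    rw [Function.extend_apply']
    · rfl
    · rintro ⟨a, rfl⟩; exact hi a.2
  · have := congrArg Subtype.val (LinearMap.mem_ker.1 hw)
    exact this

variable [DecidableEq n]

/-- Multiplication by the adjoint of an isometry does not increase the norm. -/
theorem frobNorm_transpose_mul_le {V : Matrix m n ℝ} (hV : Vᵀ * V = 1) (A : Matrix m k ℝ) :
    frobNorm (Vᵀ * A) ≤ frobNorm A := by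
  apply frobNorm_le_of_sq_le
  -- Pythagoras: this square equals `‖A‖² - ‖Vᵀ A‖²`.
  have h : 0 ≤ frobNorm (A - V * (Vᵀ * A)) ^ 2 := sq_nonneg _
  have h1 : (A - V * (Vᵀ * A))ᵀ * (A - V * (Vᵀ * A)) = Aᵀ * A - (Vᵀ * A)ᵀ * (Vᵀ * A) := by
    have : Vᵀ * (V * (Vᵀ * A)) = Vᵀ * A := by rw [← Matrix.mul_assoc, hV, Matrix.one_mul]
    simp only [Matrix.transpose_sub, Matrix.transpose_mul, Matrix.transpose_transpose,
      Matrix.mul_sub, Matrix.sub_mul, Matrix.mul_assoc, this]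
    abel
  rw [frobNorm_sq_eq_trace, h1, Matrix.trace_sub, ← frobNorm_sq_eq_trace,
    ← frobNorm_sq_eq_trace] at h
  linarith

/-- The projections onto the ranges of two orthonormal frames. -/
theorem frobNorm_proj_sub_proj_le {V W : Matrix m n ℝ} (hV : Vᵀ * V = 1) (hW : Wᵀ * W = 1) :
    frobNorm (V * Vᵀ - W * Wᵀ) ≤ √2 * frobNorm (V - W) := by
  have key : frobNorm (V * Vᵀ - W * Wᵀ) ^ 2 ≤ 2 * frobNorm (V - W) ^ 2 := by
    -- Twice this square is exactly the gap `2 ‖V - W‖² - ‖V Vᵀ - W Wᵀ‖²`.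
    have h0 : 0 ≤ frobNorm (Vᵀ * W - 1) ^ 2 := sq_nonneg _
    have e1 : (Vᵀ * W - 1)ᵀ * (Vᵀ * W - 1) = Wᵀ * V * (Vᵀ * W) - Wᵀ * V - Vᵀ * W + 1 := by
      simp [Matrix.mul_sub, Matrix.sub_mul]
      abel
    have e2 : (V - W)ᵀ * (V - W) = 1 + 1 - Wᵀ * V - Vᵀ * W := by
      simp only [Matrix.transpose_sub, Matrix.mul_sub, Matrix.sub_mul, hV, hW]
      abel
    have e3 : (V * Vᵀ - W * Wᵀ)ᵀ * (V * Vᵀ - W * Wᵀ)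
        = V * Vᵀ + W * Wᵀ - (V * (Vᵀ * W * Wᵀ)) - W * (Wᵀ * V * Vᵀ) := by
      have a1 : V * Vᵀ * (V * Vᵀ) = V * Vᵀ := by
        rw [Matrix.mul_assoc, ← Matrix.mul_assoc Vᵀ, hV, Matrix.one_mul]
      have a2 : W * Wᵀ * (W * Wᵀ) = W * Wᵀ := by
        rw [Matrix.mul_assoc, ← Matrix.mul_assoc Wᵀ, hW, Matrix.one_mul]
      simp only [Matrix.transpose_sub, Matrix.transpose_mul, Matrix.transpose_transpose,
        Matrix.mul_sub, Matrix.sub_mul, a1, a2]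
      simp only [Matrix.mul_assoc]
      abel
    rw [frobNorm_sq_eq_trace, e1] at h0
    rw [frobNorm_sq_eq_trace, frobNorm_sq_eq_trace, e2, e3]
    have t1 : (V * Vᵀ).trace = (1 : Matrix n n ℝ).trace := by rw [Matrix.trace_mul_comm, hV]
    have t2 : (W * Wᵀ).trace = (1 : Matrix n n ℝ).trace := by rw [Matrix.trace_mul_comm, hW]
    have t3 : (V * (Vᵀ * W * Wᵀ)).trace = (Wᵀ * V * (Vᵀ * W)).trace := by
      rw [Matrix.trace_mul_comm, Matrix.mul_assoc (Vᵀ * W), Matrix.trace_mul_comm]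
    have t4 : (W * (Wᵀ * V * Vᵀ)).trace = (Wᵀ * V * (Vᵀ * W)).trace := by
      rw [Matrix.trace_mul_comm, Matrix.mul_assoc (Wᵀ * V)]
    have t5 : (Wᵀ * V).trace = (Vᵀ * W).trace := by
      rw [← Matrix.trace_transpose, Matrix.transpose_mul, Matrix.transpose_transpose]
    simp only [Matrix.trace_sub, Matrix.trace_add, t1, t2, t3, t4, t5] at h0 ⊢
    linarith
  have h2 : √2 * frobNorm (V - W) = √(2 * frobNorm (V - W) ^ 2) := by
    rw [Real.sqrt_mul (by norm_num), Real.sqrt_sq (frobNorm_nonneg _)]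
  rw [h2]
  exact Real.le_sqrt_of_sq_le key

theorem rank_eq_trace_of_idempotent {P : Matrix n n ℝ} (hP : P * P = P) :
    (P.rank : ℝ) = P.trace := by
  have hproj : LinearMap.IsProj (LinearMap.range P.mulVecLin) P.mulVecLin := by
    refine ⟨fun x => LinearMap.mem_range_self _ _, ?_⟩
    rintro _ ⟨y, rfl⟩
    simp [hP]
  rw [Matrix.rank, ← hproj.trace, ← Matrix.toLin'_apply', Matrix.trace_toLin'_eq]

end Finite

/-! ### Spectral projections of matrices near a projection -/

section Spectral

variable {n : Type*} [Fintype n] [DecidableEq n]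

/-- Spectral decomposition of a real symmetric matrix. -/
theorem exists_diagonalization {A : Matrix n n ℝ} (hA : Aᵀ = A) :
    ∃ (V : Matrix n n ℝ) (l : n → ℝ), Vᵀ * V = 1 ∧ V * Vᵀ = 1 ∧
      A = V * Matrix.diagonal l * Vᵀ := by
  have hH : A.IsHermitian := by
    rwa [Matrix.IsHermitian, Matrix.conjTranspose_eq_transpose_of_trivial]
  have h1 := Unitary.coe_star_mul_self hH.eigenvectorUnitary
  rw [Matrix.star_eq_conjTranspose, Matrix.conjTranspose_eq_transpose_of_trivial] at h1
  refine ⟨hH.eigenvectorUnitary, hH.eigenvalues, h1, mul_eq_one_comm.1 h1, ?_⟩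
  have := hH.spectral_theorem
  rwa [Unitary.conjStarAlgAut_apply, Matrix.star_eq_conjTranspose,
    Matrix.conjTranspose_eq_transpose_of_trivial] at this

/-- A symmetric matrix `A` at distance less than `1/2` from a projection of rank `d` has a spectral
projection `Q` of rank `d`, and `Q` is the only maximizer of `R ↦ tr (A R)` among the `R` with
`0 ≤ R ≤ 1` and `tr R ≤ d` (in the sense that `tr (Q R) = d` for every other maximizer). -/
theorem exists_spectral_projection {A P : Matrix n n ℝ} {d : ℕ} (hA : Aᵀ = A)
    (hPP : P * P = P) (hPd : P.rank = d) (hAP : frobNorm (A - P) < 1 / 2) :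
    ∃ Q : Matrix n n ℝ, Qᵀ = Q ∧ Q * Q = Q ∧ Q.rank = d ∧ ∀ R : Matrix n n ℝ,
      (∀ v, 0 ≤ v ⬝ᵥ R *ᵥ v) → (∀ v, v ⬝ᵥ R *ᵥ v ≤ v ⬝ᵥ v) → R.trace ≤ d →
      (A * R).trace ≤ (A * Q).trace ∧ ((A * R).trace = (A * Q).trace → (Q * R).trace = d) := by
  obtain ⟨V, l, hV, hV', hVA⟩ := exists_diagonalization hA
  set S : Finset n := Finset.univ.filter fun i => 1 / 2 < l i with hS
  set χ : n → ℝ := fun i => if 1 / 2 < l i then 1 else 0 with hχ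
  have dotV : ∀ z : n → ℝ, (V *ᵥ z) ⬝ᵥ (V *ᵥ z) = z ⬝ᵥ z := fun z => by
    rw [Matrix.dotProduct_mulVec, Matrix.vecMul_mulVec, hV, Matrix.vecMul_one]
  have quadV : ∀ z : n → ℝ, (V *ᵥ z) ⬝ᵥ A *ᵥ (V *ᵥ z) = ∑ i, l i * z i ^ 2 := fun z => by
    have : A *ᵥ (V *ᵥ z) = V *ᵥ (Matrix.diagonal l *ᵥ z) := by
      rw [hVA, Matrix.mulVec_mulVec, Matrix.mul_assoc, hV, Matrix.mul_one, Matrix.mulVec_mulVec]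
    rw [this, Matrix.dotProduct_mulVec, Matrix.vecMul_mulVec, hV, Matrix.vecMul_one]
    simp only [dotProduct, Matrix.mulVec_diagonal]
    exact Finset.sum_congr rfl fun i _ => by ring
  have near : ∀ x : n → ℝ, x ≠ 0 → |x ⬝ᵥ (A - P) *ᵥ x| < 1 / 2 * (x ⬝ᵥ x) := fun x hx =>
    (abs_dotProduct_mulVec_le _ x).trans_lt
      (mul_lt_mul_of_pos_right hAP (dotProduct_self_pos hx))
  have hVz : ∀ z : n → ℝ, z ≠ 0 → V *ᵥ z ≠ 0 := fun z hz h => by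
    have := dotV z
    rw [h, zero_dotProduct] at this
    exact hz (dotProduct_self_eq_zero.1 this.symm)
  -- Exactly `d` eigenvalues exceed `1/2`. With more of them, `P` would kill a vector in the span of
  -- their eigenvectors; with fewer, `P` would fix a vector in the span of the others. Either way
  -- the quadratic form of `A - P` would be at least `1/2` in absolute value on a unit vector.
  have hcard : S.card = d := by
    apply le_antisymm
    · by_contra! hlt
      have hr : (P * V).rank < S.card := (Matrix.rank_mul_le_left _ _).trans_lt (hPd ▸ hlt)
      obtain ⟨z, hz0, hzS, hz⟩ := exists_mulVec_eq_zero_of_rank_lt hr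
      have h1 := near _ (hVz z hz0)
      rw [Matrix.sub_mulVec, dotProduct_sub, quadV, Matrix.mulVec_mulVec, hz, dotProduct_zero,
        sub_zero, dotV] at h1
      have h2 : 1 / 2 * (z ⬝ᵥ z) ≤ ∑ i, l i * z i ^ 2 := by
        rw [dotProduct, Finset.mul_sum]
        refine Finset.sum_le_sum fun i _ => ?_
        by_cases hi : i ∈ S
        · have : 1 / 2 < l i := by simpa [hS] using hi
          nlinarith [sq_nonneg (z i)]
        · simp [hzS i hi]
      linarith [le_abs_self (∑ i, l i * z i ^ 2)]
    · by_contra! hlt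
      have hr1 : ((1 - P).rank : ℝ) = Fintype.card n - d := by
        rw [rank_eq_trace_of_idempotent (by simp [Matrix.mul_sub, Matrix.sub_mul, hPP]),
          Matrix.trace_sub, Matrix.trace_one, ← rank_eq_trace_of_idempotent hPP, hPd]
      have hr2 : (1 - P).rank < (Sᶜ).card := by
        have h3 : (1 - P).rank + d = Fintype.card n := by
          have : (((1 - P).rank + d : ℕ) : ℝ) = Fintype.card n := by push_cast; linarith
          exact_mod_cast this
        have h4 := Finset.card_add_card_compl S
        omega
      obtain ⟨z, hz0, hzS, hz⟩ := exists_mulVec_eq_zero_of_rank_lt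
        ((Matrix.rank_mul_le_left (1 - P) V).trans_lt hr2)
      have h1 := near _ (hVz z hz0)
      have hPz : P *ᵥ (V *ᵥ z) = V *ᵥ z := by
        rw [← Matrix.mulVec_mulVec, Matrix.sub_mulVec, Matrix.one_mulVec] at hz
        exact (sub_eq_zero.1 hz).symm
      rw [Matrix.sub_mulVec, dotProduct_sub, quadV, hPz, dotV] at h1
      have h2 : ∑ i, l i * z i ^ 2 ≤ 1 / 2 * (z ⬝ᵥ z) := by
        rw [dotProduct, Finset.mul_sum]
        refine Finset.sum_le_sum fun i _ => ?_
        by_cases hi : i ∈ S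
        · simp [hzS i (by simpa using hi)]
        · have : l i ≤ 1 / 2 := by simpa [hS] using hi
          nlinarith [sq_nonneg (z i)]
      have := neg_abs_le (∑ i, l i * z i ^ 2 - z ⬝ᵥ z)
      linarith
  have hχχ : Matrix.diagonal χ * Matrix.diagonal χ = Matrix.diagonal χ := by
    rw [Matrix.diagonal_mul_diagonal]
    congr 1
    ext i
    simp [hχ]
  set Q := V * Matrix.diagonal χ * Vᵀ with hQ
  have hQQ : Q * Q = Q := by
    calc Q * Q = V * Matrix.diagonal χ * (Vᵀ * V) * Matrix.diagonal χ * Vᵀ := by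
          simp only [hQ, Matrix.mul_assoc]
      _ = V * (Matrix.diagonal χ * Matrix.diagonal χ) * Vᵀ := by
          rw [hV, Matrix.mul_one]; simp only [Matrix.mul_assoc]
      _ = Q := by rw [hχχ]
  have trconj : ∀ (D R : Matrix n n ℝ), (V * D * Vᵀ * R).trace = (D * (Vᵀ * R * V)).trace := by
    intro D R
    rw [Matrix.mul_assoc, Matrix.mul_assoc, Matrix.trace_mul_comm]
    simp only [Matrix.mul_assoc]
  have sumχ : ∑ i, χ i = d := by
    rw [← hcard, hS, Finset.card_filter]
    push_cast
    rfl
  have trdiag : ∀ (c : n → ℝ) (T : Matrix n n ℝ),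
      (Matrix.diagonal c * T).trace = ∑ i, c i * T i i := fun c T => by
    simp [Matrix.trace, Matrix.diagonal_mul]
  refine ⟨Q, ?_, hQQ, ?_, ?_⟩
  · simp [hQ, Matrix.transpose_mul, Matrix.mul_assoc]
  · have := rank_eq_trace_of_idempotent hQQ
    rw [← Matrix.mul_one Q, hQ, trconj, Matrix.mul_one, Matrix.mul_one, hV, trdiag] at this
    simp only [Matrix.one_apply_eq, mul_one, sumχ] at this
    rw [← hQ] at this
    exact_mod_cast this
  · intro R hR0 hR1 hRd
    -- The diagonal of `R` in the eigenbasis of `A`. Only these numbers in `[0, 1]` enter `tr (A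
    -- R)`, so the maximization becomes a linear program.
    set r : n → ℝ := fun i => (Vᵀ * R * V) i i with hr
    have hri : ∀ i, r i = (V.col i) ⬝ᵥ R *ᵥ (V.col i) := fun i => by
      simp only [hr, Matrix.mul_assoc]
      rw [Matrix.mul_apply]
      simp only [dotProduct, Matrix.mulVec, Matrix.mul_apply, Matrix.transpose_apply, Matrix.col]
    have hr0 : ∀ i, 0 ≤ r i := fun i => hri i ▸ hR0 _
    have hr1 : ∀ i, r i ≤ 1 := fun i => by
      rw [hri]
      refine (hR1 _).trans (le_of_eq ?_)
      have := congrFun (congrFun hV i) i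
      simpa [Matrix.mul_apply, dotProduct] using this
    have hAR : (A * R).trace = ∑ i, l i * r i := by rw [hVA, trconj, trdiag]
    have hQR : (Q * R).trace = ∑ i, χ i * r i := by rw [hQ, trconj, trdiag]
    have hAQ : (A * Q).trace = ∑ i, l i * χ i := by
      have : Vᵀ * Q * V = Matrix.diagonal χ := by
        calc Vᵀ * Q * V = (Vᵀ * V) * Matrix.diagonal χ * (Vᵀ * V) := by
              simp only [hQ, Matrix.mul_assoc]
          _ = _ := by rw [hV, Matrix.one_mul, Matrix.mul_one]
      rw [hVA, trconj, this, trdiag]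
      simp
    have hsr : ∑ i, r i ≤ d := by
      have h5 : (Vᵀ * R * V).trace = R.trace := by
        rw [Matrix.trace_mul_comm, ← Matrix.mul_assoc, hV', Matrix.one_mul]
      calc ∑ i, r i = (Vᵀ * R * V).trace := rfl
        _ ≤ d := h5 ▸ hRd
    have hterm : ∀ i, 0 ≤ (l i - 1 / 2) * (χ i - r i) := fun i => by
      by_cases hi : 1 / 2 < l i
      · simp only [hχ, hi, if_true]
        exact mul_nonneg (by linarith) (by linarith [hr1 i])
      · simp only [hχ, hi, if_false]
        nlinarith [hr0 i]
    -- The threshold `1/2` acts as a Lagrange multiplier for the constraint `tr R ≤ d`; both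
    -- summands are nonnegative. Equality forces `r i = 1` wherever `l i > 1/2`.
    have hsum : (A * Q).trace - (A * R).trace
        = ∑ i, (l i - 1 / 2) * (χ i - r i) + 1 / 2 * (d - ∑ i, r i) := by
      rw [hAQ, hAR, ← sumχ, ← Finset.sum_sub_distrib, ← Finset.sum_sub_distrib, Finset.mul_sum,
        ← Finset.sum_add_distrib]
      exact Finset.sum_congr rfl fun i _ => by ring
    have hnn := Finset.sum_nonneg fun i (_ : i ∈ Finset.univ) => hterm i
    refine ⟨by linarith, fun heq => ?_⟩
    have hz : ∑ i, (l i - 1 / 2) * (χ i - r i) = 0 := by linarith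
    rw [Finset.sum_eq_zero_iff_of_nonneg fun i _ => hterm i] at hz
    rw [hQR, ← sumχ]
    refine Finset.sum_congr rfl fun i _ => ?_
    by_cases hi : 1 / 2 < l i
    · have := hz i (Finset.mem_univ i)
      simp only [hχ, hi, if_true] at this ⊢
      rcases mul_eq_zero.1 this with h | h <;> linarith
    · simp only [hχ, hi, if_false, zero_mul]

end Spectral

/-! ### Continuity of the square root and inverse square root -/

section Sqrt

variable {n : Type*} [Fintype n]

theorem posSemidef_iff {M : Matrix n n ℝ} :
    M.PosSemidef ↔ Mᵀ = M ∧ ∀ x : n → ℝ, 0 ≤ x ⬝ᵥ M *ᵥ x := by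
  constructor
  · intro h
    refine ⟨?_, fun x => by simpa using h.dotProduct_mulVec_nonneg x⟩
    rw [← Matrix.conjTranspose_eq_transpose_of_trivial]
    exact h.isHermitian
  · rintro ⟨h1, h2⟩
    refine .of_dotProduct_mulVec_nonneg ?_ fun x => by simpa using h2 x
    rwa [Matrix.IsHermitian, Matrix.conjTranspose_eq_transpose_of_trivial]

/-- A map with closed graph and relatively compact values is continuous. -/
theorem tendsto_of_isClosed_graph {X Y : Type*} [TopologicalSpace X] [TopologicalSpace Y]
    {f : X → Y} {x₀ : X} {y₀ : Y} {l : Filter X} (hl : l ≤ 𝓝 x₀) {K : Set Y} (hK : IsCompact K)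
    {G : Set (X × Y)} (hG : IsClosed G) (hfK : ∀ᶠ x in l, f x ∈ K)
    (hfG : ∀ᶠ x in l, (x, f x) ∈ G) (huniq : ∀ y ∈ K, (x₀, y) ∈ G → y = y₀) :
    Filter.Tendsto f l (𝓝 y₀) := by
  refine hK.tendsto_nhds_of_unique_mapClusterPt hfK fun y hy hcl => huniq y hy ?_
  obtain ⟨u, hu, hut⟩ := mapClusterPt_iff_ultrafilter.1 hcl
  have h1 : Filter.Tendsto (fun x => (x, f x)) u (𝓝 (x₀, y)) :=
    Filter.Tendsto.prodMk_nhds (hu.trans hl) hut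
  exact hG.mem_of_tendsto h1 (hu hfG)

theorem continuous_frobNorm {m : Type*} [Fintype m] :
    Continuous (frobNorm : Matrix m n ℝ → ℝ) := by
  unfold frobNorm
  simp only [tsum_fintype]
  fun_prop

theorem isCompact_frobNorm_le {m : Type*} [Fintype m] (C : ℝ) :
    IsCompact {A : Matrix m n ℝ | frobNorm A ≤ C} := by
  have hbox : IsCompact (Set.univ.pi fun _ => Set.univ.pi fun _ => Set.Icc (-C) C :
      Set (m → n → ℝ)) :=
    isCompact_univ_pi fun _ => isCompact_univ_pi fun _ => isCompact_Icc
  refine IsCompact.of_isClosed_subset hbox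
    (isClosed_le continuous_frobNorm continuous_const) ?_
  intro A hA i _ j _
  have hA' : frobNorm A ≤ C := hA
  have h1 : A i j ^ 2 ≤ ∑ j, A i j ^ 2 :=
    Finset.single_le_sum (f := fun j => A i j ^ 2) (fun _ _ => sq_nonneg _) (Finset.mem_univ j)
  have h2 : ∑ j, A i j ^ 2 ≤ ∑ i, ∑ j, A i j ^ 2 :=
    Finset.single_le_sum (f := fun i => ∑ j, A i j ^ 2)
      (fun _ _ => Finset.sum_nonneg fun _ _ => sq_nonneg _) (Finset.mem_univ i)
  rw [← frobNorm_sq] at h2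
  have h3 := abs_le_of_sq_le_sq' (h1.trans h2) (frobNorm_nonneg _)
  exact ⟨by linarith [h3.1], by linarith [h3.2]⟩

variable [DecidableEq n]

open scoped MatrixOrder in
/-- The square root of a positive semidefinite matrix. -/
def psdSqrt (M : Matrix n n ℝ) : Matrix n n ℝ := CFC.sqrt M

open scoped MatrixOrder in
theorem posSemidef_sqrt (M : Matrix n n ℝ) : (psdSqrt M).PosSemidef :=
  Matrix.nonneg_iff_posSemidef.1 (CFC.sqrt_nonneg M)

open scoped MatrixOrder in
theorem sqrt_mul_sqrt {M : Matrix n n ℝ} (hM : M.PosSemidef) : psdSqrt M * psdSqrt M = M :=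
  CFC.sqrt_mul_sqrt_self M hM.nonneg

open scoped MatrixOrder in
theorem sqrt_eq_of_mul_self {M S : Matrix n n ℝ} (hM : M.PosSemidef) (hS : S.PosSemidef)
    (h : S * S = M) : psdSqrt M = S :=
  (CFC.sqrt_eq_iff M S hM.nonneg hS.nonneg).2 h

/-- The conditions `S ≥ 0` and `S * S = M` are closed and determine `S`, and `‖S‖² = tr M` bounds
`S` locally; hence `tendsto_of_isClosed_graph` applies. -/
theorem continuousOn_sqrt :
    ContinuousOn (psdSqrt : Matrix n n ℝ → Matrix n n ℝ) {M | M.PosSemidef} := by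
  intro M₀ hM₀
  set C := √(M₀.trace + 1)
  have hG : IsClosed {p : Matrix n n ℝ × Matrix n n ℝ | p.2.PosSemidef ∧ p.2 * p.2 = p.1} := by
    simp only [posSemidef_iff, Set.ofPred_and, Set.ofPred_forall]
    refine IsClosed.inter (IsClosed.inter ?_ (isClosed_iInter fun x => ?_)) ?_
    · exact isClosed_eq (by fun_prop) (by fun_prop)
    · exact isClosed_le (by fun_prop) (by fun_prop)
    · exact isClosed_eq (by fun_prop) (by fun_prop)
  refine tendsto_of_isClosed_graph (l := 𝓝[{M | M.PosSemidef}] M₀) nhdsWithin_le_nhds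
    (isCompact_frobNorm_le C) hG ?_ ?_ ?_
  · have h1 : ∀ᶠ M : Matrix n n ℝ in 𝓝[{M | M.PosSemidef}] M₀, M.trace < M₀.trace + 1 := by
      refine nhdsWithin_le_nhds ?_
      have : Continuous fun M : Matrix n n ℝ => M.trace := by fun_prop
      exact this.continuousAt.eventually_lt continuousAt_const (by linarith)
    filter_upwards [h1, self_mem_nhdsWithin] with M hM hM'
    refine Real.le_sqrt_of_sq_le ?_
    rw [frobNorm_sq_eq_trace, (posSemidef_iff.1 (posSemidef_sqrt M)).1, sqrt_mul_sqrt hM']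
    exact hM.le
  · filter_upwards [self_mem_nhdsWithin] with M hM
    exact ⟨posSemidef_sqrt M, sqrt_mul_sqrt hM⟩
  · rintro S - ⟨hS, hSS⟩
    exact (sqrt_eq_of_mul_self hM₀ hS hSS).symm

/-- The inverse square root of a positive definite matrix. -/
def invSqrt (M : Matrix n n ℝ) : Matrix n n ℝ := (psdSqrt M)⁻¹

theorem isUnit_det_sqrt {M : Matrix n n ℝ} (hM : M.PosDef) : IsUnit (psdSqrt M).det := by
  have h := (Matrix.isUnit_iff_isUnit_det _).1 hM.isUnit
  rw [← sqrt_mul_sqrt hM.posSemidef, Matrix.det_mul] at h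
  exact isUnit_of_mul_isUnit_left h

theorem continuousOn_invSqrt :
    ContinuousOn (invSqrt : Matrix n n ℝ → Matrix n n ℝ) {M | M.PosDef} := by
  intro M hM
  have h1 : ContinuousWithinAt (psdSqrt : Matrix n n ℝ → Matrix n n ℝ) {M | M.PosDef} M :=
    (continuousOn_sqrt.mono fun _ h => h.posSemidef) M hM
  refine ContinuousAt.comp_continuousWithinAt (g := fun A : Matrix n n ℝ => A⁻¹) ?_ h1
  apply continuousAt_matrix_inv
  rw [Ring.inverse_eq_inv']
  exact continuousAt_inv₀ (isUnit_det_sqrt hM).ne_zero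

end Sqrt

/-! ### Polar decomposition of a projected frame -/

section Polar

variable {m n : Type*} [Fintype m] [Fintype n] [DecidableEq n]

/-- The frame of the range of `Q` closest to a given orthonormal frame `Φ`. -/
theorem polar_frame {Φ : Matrix m n ℝ} {Q : Matrix m m ℝ} (hΦ : Φᵀ * Φ = 1) (hQ : Qᵀ = Q)
    (hQQ : Q * Q = Q) (hQd : Q.rank = Fintype.card n) (hlt : frobNorm (Φ * Φᵀ - Q) < 1) :
    (Φᵀ * (Q * Φ)).PosDef ∧
    (Q * Φ * invSqrt (Φᵀ * (Q * Φ)))ᵀ * (Q * Φ * invSqrt (Φᵀ * (Q * Φ))) = 1 ∧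
    (Q * Φ * invSqrt (Φᵀ * (Q * Φ))) * (Q * Φ * invSqrt (Φᵀ * (Q * Φ)))ᵀ = Q ∧
    frobNorm (Φ - Q * Φ * invSqrt (Φᵀ * (Q * Φ))) ≤ frobNorm (Φ * Φᵀ - Q) := by
  classical
  set M := Φᵀ * (Q * Φ) with hM
  have hMT : Mᵀ = M := by
    simp only [hM, Matrix.transpose_mul, Matrix.transpose_transpose, hQ, Matrix.mul_assoc]
  have hMpos : M.PosDef := by
    refine .of_dotProduct_mulVec_pos ?_ fun x hx => ?_
    · rwa [Matrix.IsHermitian, Matrix.conjTranspose_eq_transpose_of_trivial]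
    · have e1 : x ⬝ᵥ M *ᵥ x = (Q *ᵥ (Φ *ᵥ x)) ⬝ᵥ (Q *ᵥ (Φ *ᵥ x)) := by
        rw [Matrix.dotProduct_mulVec (Q *ᵥ (Φ *ᵥ x)), Matrix.vecMul_mulVec, hQ, hQQ,
          ← Matrix.dotProduct_mulVec, Matrix.mulVec_mulVec, Matrix.dotProduct_mulVec,
          Matrix.dotProduct_mulVec, ← Matrix.vecMul_transpose, Matrix.vecMul_vecMul]
      rw [star_trivial, e1]
      refine dotProduct_self_pos fun h0 => ?_
      have hΦx : (Φ *ᵥ x) ⬝ᵥ (Φ *ᵥ x) = x ⬝ᵥ x := by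
        rw [Matrix.dotProduct_mulVec, Matrix.vecMul_mulVec, hΦ, Matrix.vecMul_one]
      -- If `Q Φ x = 0`, the quadratic form of `Φ Φᵀ - Q` at `Φ x` equals `|x|² = |Φ x|²`, which a
      -- matrix of norm below `1` does not allow.
      have h2 := abs_dotProduct_mulVec_le (Φ * Φᵀ - Q) (Φ *ᵥ x)
      rw [Matrix.sub_mulVec, h0, sub_zero, ← Matrix.mulVec_mulVec, Matrix.mulVec_mulVec _ Φᵀ, hΦ,
        Matrix.one_mulVec, hΦx] at h2
      have h3 := dotProduct_self_pos hx
      rw [abs_of_pos h3] at h2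
      nlinarith
  set S := psdSqrt M with hS
  have hSS : S * S = M := sqrt_mul_sqrt hMpos.posSemidef
  have hSp : S.PosSemidef := posSemidef_sqrt M
  have hST : Sᵀ = S := (posSemidef_iff.1 hSp).1
  have hu := isUnit_det_sqrt hMpos
  have hR : invSqrt M = S⁻¹ := rfl
  have hRS : S⁻¹ * S = 1 := Matrix.nonsing_inv_mul _ hu
  have hSR : S * S⁻¹ = 1 := Matrix.mul_nonsing_inv _ hu
  have hRT : (S⁻¹)ᵀ = S⁻¹ := by rw [Matrix.transpose_nonsing_inv, hST]
  rw [hR]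
  set Ψ := Q * Φ * S⁻¹ with hΨ
  have hΨT : Ψᵀ = S⁻¹ * (Φᵀ * Q) := by
    rw [hΨ, Matrix.transpose_mul, Matrix.transpose_mul, hRT, hQ]
  have hΦΨ : Φᵀ * Ψ = S := by
    calc Φᵀ * Ψ = M * S⁻¹ := by simp only [hΨ, hM, Matrix.mul_assoc]
      _ = S := by rw [← hSS, Matrix.mul_assoc, hSR, Matrix.mul_one]
  have hQΨ : Q * Ψ = Ψ := by rw [hΨ, ← Matrix.mul_assoc, ← Matrix.mul_assoc, hQQ]
  have hΨΨ : Ψᵀ * Ψ = 1 := by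
    rw [hΨT, Matrix.mul_assoc, Matrix.mul_assoc, hQΨ, hΦΨ, hRS]
  have trQ : Q.trace = (1 : Matrix n n ℝ).trace := by
    rw [← rank_eq_trace_of_idempotent hQQ, hQd, Matrix.trace_one]
  -- The range of `Ψ` lies in that of `Q`, so `Q - Ψ Ψᵀ` is a projection; its trace, hence its
  -- squared norm, is `d - d = 0` with `d = Fintype.card n`.
  have hproj : Ψ * Ψᵀ = Q := by
    have hΨQ : Ψᵀ * Q = Ψᵀ := by
      rw [← hQ, ← Matrix.transpose_mul, hQΨ]
    have e1 : (Q - Ψ * Ψᵀ)ᵀ * (Q - Ψ * Ψᵀ) = Q - Ψ * Ψᵀ := by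
      have a1 : Q * (Ψ * Ψᵀ) = Ψ * Ψᵀ := by rw [← Matrix.mul_assoc, hQΨ]
      have a2 : Ψ * Ψᵀ * Q = Ψ * Ψᵀ := by rw [Matrix.mul_assoc, hΨQ]
      have a3 : Ψ * Ψᵀ * (Ψ * Ψᵀ) = Ψ * Ψᵀ := by
        rw [Matrix.mul_assoc, ← Matrix.mul_assoc Ψᵀ, hΨΨ, Matrix.one_mul]
      simp only [Matrix.transpose_sub, Matrix.transpose_mul, Matrix.transpose_transpose,
        Matrix.mul_sub, Matrix.sub_mul, a1, a2, a3, hQ, hQQ]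
      abel
    have h0 : frobNorm (Q - Ψ * Ψᵀ) ^ 2 = 0 := by
      rw [frobNorm_sq_eq_trace, e1, Matrix.trace_sub, Matrix.trace_mul_comm Ψ, hΨΨ, trQ, sub_self]
    exact (sub_eq_zero.1 (frobNorm_eq_zero (by simpa using h0))).symm
  refine ⟨hMpos, hΨΨ, hproj, frobNorm_le_of_sq_le ?_⟩
  have tΨΦ : (Ψᵀ * Φ).trace = S.trace := by
    rw [← Matrix.trace_transpose, Matrix.transpose_mul, Matrix.transpose_transpose, hΦΨ]
  have d1 : frobNorm (Φ - Ψ) ^ 2 = 2 * (1 - S).trace := by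
    rw [frobNorm_sq_eq_trace]
    simp only [Matrix.transpose_sub, Matrix.mul_sub, Matrix.sub_mul, hΦ, hΨΨ, Matrix.trace_sub,
      tΨΦ, hΦΨ]
    ring
  have d2 : frobNorm (Φ * Φᵀ - Q) ^ 2 = 2 * (1 - M).trace := by
    have a1 : Φ * Φᵀ * (Φ * Φᵀ) = Φ * Φᵀ := by
      rw [Matrix.mul_assoc, ← Matrix.mul_assoc Φᵀ, hΦ, Matrix.one_mul]
    have a2 : (Φ * Φᵀ).trace = (1 : Matrix n n ℝ).trace := by rw [Matrix.trace_mul_comm, hΦ]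
    have a3 : (Q * (Φ * Φᵀ)).trace = M.trace := by
      rw [← Matrix.mul_assoc, Matrix.trace_mul_comm]
    have a4 : (Φ * Φᵀ * Q).trace = M.trace := by rw [Matrix.trace_mul_comm, a3]
    rw [frobNorm_sq_eq_trace]
    simp only [Matrix.transpose_sub, Matrix.transpose_mul, Matrix.transpose_transpose, hQ,
      Matrix.mul_sub, Matrix.sub_mul, a1, hQQ, Matrix.trace_sub, a2, a3, a4, trQ]
    ring
  -- On eigenvalues, with `M = S²`: `2 (1 - s) = (1 - s²) + (1 - s)²`. It remains to bound `‖1 -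
  -- S‖²` by `tr (1 - M)`, which `d4` and `d5` do in two steps.
  have d3 : 2 * (1 - S).trace = (1 - M).trace + frobNorm (1 - S) ^ 2 := by
    rw [frobNorm_sq_eq_trace]
    simp only [Matrix.transpose_sub, Matrix.transpose_one, hST, Matrix.mul_sub, Matrix.sub_mul,
      Matrix.mul_one, Matrix.one_mul, hSS, Matrix.trace_sub]
    ring
  -- On eigenvalues: `(1 - s²)² - (1 - s)² = 2 s (1 - s)² + (s (1 - s))²`. The two terms are the
  -- traces in `hps'` (doubled) and `hsq`.
  have d4 : frobNorm (1 - S) ^ 2 ≤ frobNorm (1 - M) ^ 2 := by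
    have hps : ((1 - S) * S * (1 - S)ᴴ).PosSemidef := hSp.mul_mul_conjTranspose_same _
    have hps' := hps.trace_nonneg
    have hSSS : (S * S * S).trace = (S * M).trace := by rw [Matrix.mul_assoc, hSS]
    rw [Matrix.conjTranspose_eq_transpose_of_trivial] at hps'
    have hsq : 0 ≤ frobNorm ((1 - S) * S) ^ 2 := sq_nonneg _
    rw [frobNorm_sq_eq_trace] at hsq ⊢
    rw [frobNorm_sq_eq_trace]
    simp only [Matrix.transpose_sub, Matrix.transpose_one, hST, hMT,
      Matrix.mul_sub, Matrix.sub_mul, Matrix.mul_one, Matrix.one_mul, hSS, Matrix.trace_sub] at hps' hsq ⊢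
    have b1 : (S * (S * S)).trace = (S * M).trace := by rw [hSS]
    have b2 : (S * (M * S)).trace = (M * M).trace := by
      rw [Matrix.trace_mul_comm, Matrix.mul_assoc, hSS]
    have b3 : (M * S).trace = (S * M).trace := Matrix.trace_mul_comm _ _
    simp only [b3] at hps' hsq ⊢
    linarith
  -- The difference is `tr (M (1 - M))`, which is the squared norm of `Q Φ Φᵀ (1 - Q)`.
  have d5 : frobNorm (1 - M) ^ 2 ≤ (1 - M).trace := by
    have h0 : 0 ≤ frobNorm (Q * Φ * (1 - M)) ^ 2 := sq_nonneg _
    have h1 : 0 ≤ frobNorm (Q * (Φ * Φᵀ) * (1 - Q)) ^ 2 := sq_nonneg _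
    have e1 : (Q * (Φ * Φᵀ) * (1 - Q))ᵀ * (Q * (Φ * Φᵀ) * (1 - Q))
        = (1 - Q) * (Φ * (M * (Φᵀ * (1 - Q)))) := by
      simp only [Matrix.transpose_mul, Matrix.transpose_sub, Matrix.transpose_one,
        Matrix.transpose_transpose, hQ, hM, Matrix.mul_assoc]
      rw [← Matrix.mul_assoc Q Q, hQQ]
    have e2 : Φᵀ * ((1 - Q) * ((1 - Q) * Φ)) = 1 - M := by
      have : (1 - Q) * (1 - Q) = 1 - Q := by simp [Matrix.mul_sub, Matrix.sub_mul, hQQ]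
      rw [← Matrix.mul_assoc (1 - Q), this, Matrix.sub_mul, Matrix.one_mul, Matrix.mul_sub, hΦ]
    have e3 : ((1 - Q) * (Φ * (M * (Φᵀ * (1 - Q))))).trace = (M * (1 - M)).trace := by
      rw [← e2, Matrix.trace_mul_comm]
      simp only [Matrix.mul_assoc]
      rw [Matrix.trace_mul_comm Φ]
      simp only [Matrix.mul_assoc]
    rw [frobNorm_sq_eq_trace, e1, e3] at h1
    rw [frobNorm_sq_eq_trace]
    simp only [Matrix.transpose_sub, Matrix.transpose_one, hMT, Matrix.mul_sub, Matrix.sub_mul,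
      Matrix.mul_one, Matrix.one_mul, Matrix.trace_sub] at h1 ⊢
    linarith
  linarith

end Polar

/-! ### Infinite matrices with finite support -/

/-- The matrix is zero outside of its upper left `n × n` corner. -/
def SuppIn (n : ℕ) (A : Matrix ℕ ℕ ℝ) : Prop := ∀ i j : ℕ, (n ≤ i ∨ n ≤ j) → A i j = 0

/-- The upper left `n × n` corner of an infinite matrix. -/
def corner (n : ℕ) (A : Matrix ℕ ℕ ℝ) : Matrix (Fin n) (Fin n) ℝ :=
  A.submatrix Fin.val Fin.val

/-- The Frobenius inner product of infinite matrices. -/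
def frobInner (A B : Matrix ℕ ℕ ℝ) : ℝ := ∑' p : ℕ × ℕ, A p.1 p.2 * B p.1 p.2

theorem SuppIn.mono {n m : ℕ} (h : n ≤ m) {A : Matrix ℕ ℕ ℝ} (hA : SuppIn n A) : SuppIn m A :=
  fun i j hij => hA i j (hij.imp h.trans h.trans)

theorem SuppIn.sub {n : ℕ} {A B : Matrix ℕ ℕ ℝ} (hA : SuppIn n A) (hB : SuppIn n B) :
    SuppIn n (A - B) := fun i j hij => by
  rw [Matrix.sub_apply, hA i j hij, hB i j hij, sub_zero]

theorem InfMat.ext {A B : InfMat} (h : A.entries = B.entries) : A = B := by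
  cases A; cases B; cases h; rfl

theorem InfMat.suppIn_pad (n : ℕ) (A : Matrix (Fin n) (Fin n) ℝ) : SuppIn n (pad n A).entries :=
  fun i j hij => dif_neg (by omega)

theorem InfMat.corner_pad (n : ℕ) (A : Matrix (Fin n) (Fin n) ℝ) :
    corner n (pad n A).entries = A := by
  ext i j
  exact dif_pos ⟨i.2, j.2⟩

theorem InfMat.pad_corner {n : ℕ} {A : InfMat} (hA : SuppIn n A.entries) :
    pad n (corner n A.entries) = A := by
  apply InfMat.ext
  ext i j
  by_cases h : i < n ∧ j < n
  · simp [pad, h, corner]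
  · rw [hA i j (by omega)]
    simp [pad, h]

theorem trace_transpose_mul_eq_sum {n : ℕ} (A B : Matrix (Fin n) (Fin n) ℝ) :
    (Aᵀ * B).trace = ∑ p : Fin n × Fin n, A p.1 p.2 * B p.1 p.2 := by
  rw [Fintype.sum_prod_type, Finset.sum_comm]
  simp [Matrix.trace, Matrix.mul_apply]

theorem frobInner_eq {n : ℕ} {A : Matrix ℕ ℕ ℝ} (hA : SuppIn n A) (B : Matrix ℕ ℕ ℝ) :
    frobInner A B = ((corner n A)ᵀ * corner n B).trace := by
  rw [trace_transpose_mul_eq_sum, frobInner]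
  have hinj : Function.Injective (Prod.map Fin.val Fin.val : Fin n × Fin n → ℕ × ℕ) :=
    Function.Injective.prodMap Fin.val_injective Fin.val_injective
  rw [← hinj.tsum_eq, tsum_fintype]
  · rfl
  · intro p hp
    have h : p.1 < n ∧ p.2 < n := by
      by_contra h
      exact hp (by simp [hA p.1 p.2 (by omega)])
    exact ⟨(⟨p.1, h.1⟩, ⟨p.2, h.2⟩), rfl⟩

theorem frobNorm_sq_eq_frobInner (A : Matrix ℕ ℕ ℝ) : frobNorm A ^ 2 = frobInner A A := by
  rw [frobNorm, Real.sq_sqrt (tsum_nonneg fun _ => sq_nonneg _), frobInner]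
  simp only [sq]

theorem frobNorm_corner {n : ℕ} {A : Matrix ℕ ℕ ℝ} (hA : SuppIn n A) :
    frobNorm (corner n A) = frobNorm A := by
  rw [← Real.sqrt_sq (frobNorm_nonneg A), ← Real.sqrt_sq (frobNorm_nonneg (corner n A)),
    frobNorm_sq_eq_frobInner, frobInner_eq hA, frobNorm_sq_eq_trace]

theorem corner_sub (n : ℕ) (A B : Matrix ℕ ℕ ℝ) : corner n (A - B) = corner n A - corner n B :=
  rfl

theorem InfMat.frobDist_eq {n : ℕ} {A B : InfMat} (hA : SuppIn n A.entries)
    (hB : SuppIn n B.entries) :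
    A.frobDist B = frobNorm (corner n A.entries - corner n B.entries) := by
  rw [frobDist, ← frobNorm_corner (hA.sub hB), corner_sub]

theorem InfMat.frobDist_nonneg (A B : InfMat) : 0 ≤ A.frobDist B := frobNorm_nonneg _

theorem InfMat.frobDist_comm (A B : InfMat) : A.frobDist B = B.frobDist A :=
  frobNorm_sub_comm _ _

theorem InfMat.frobDist_self (A : InfMat) : A.frobDist A = 0 := by
  rw [frobDist, sub_self, frobNorm_zero]

theorem InfMat.exists_suppIn (A : InfMat) : ∃ n, SuppIn n A.entries := A.finite_support

theorem InfMat.frobDist_triangle (A B C : InfMat) :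
    A.frobDist C ≤ A.frobDist B + B.frobDist C := by
  obtain ⟨a, ha⟩ := A.exists_suppIn
  obtain ⟨b, hb⟩ := B.exists_suppIn
  obtain ⟨c, hc⟩ := C.exists_suppIn
  have ha' := ha.mono (show a ≤ a + b + c by omega)
  have hb' := hb.mono (show b ≤ a + b + c by omega)
  have hc' := hc.mono (show c ≤ a + b + c by omega)
  rw [frobDist_eq ha' hb', frobDist_eq hb' hc', frobDist_eq ha' hc']
  exact frobNorm_sub_le _ _ _

theorem InfMat.frobDist_sq {A B : InfMat} :
    A.frobDist B ^ 2 = frobInner A.entries A.entries - 2 * frobInner A.entries B.entries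
      + frobInner B.entries B.entries := by
  obtain ⟨a, ha⟩ := A.exists_suppIn
  obtain ⟨b, hb⟩ := B.exists_suppIn
  have ha' := ha.mono (show a ≤ a + b by omega)
  have hb' := hb.mono (show b ≤ a + b by omega)
  rw [frobDist_eq ha' hb', frobInner_eq ha', frobInner_eq ha', frobInner_eq hb',
    trace_transpose_mul_eq_sum, trace_transpose_mul_eq_sum, trace_transpose_mul_eq_sum,
    frobNorm_sq, ← Fintype.sum_prod_type', Finset.mul_sum, ← Finset.sum_sub_distrib,
    ← Finset.sum_add_distrib]
  exact Finset.sum_congr rfl fun p _ => by rw [Matrix.sub_apply]; ring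

/-! ### The topology of the space of infinite matrices -/

theorem InfMat.isOpen_iff {s : Set InfMat} : IsOpen s ↔ ∀ n, IsOpen (pad n ⁻¹' s) := by
  simp only [isOpen_iSup_iff, isOpen_coinduced]

theorem InfMat.continuous_pad (n : ℕ) : Continuous (pad n) :=
  continuous_def.2 fun _ hs => isOpen_iff.1 hs n

theorem continuous_corner (n : ℕ) : Continuous (corner n) := by
  unfold corner
  fun_prop

theorem InfMat.continuous_iff {Y : Type*} [TopologicalSpace Y] {g : InfMat → Y} :
    Continuous g ↔ ∀ n, Continuous fun M => g (pad n M) := by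
  simp only [continuous_def, isOpen_iff]
  exact ⟨fun h n s hs => h s hs n, fun h s hs n => h n s hs⟩

/-- Entrywise continuity alone does not suffice for the direct limit topology. With a local bound on
the support, `f` factors locally through a single `ℝ^{n×n}`. -/
theorem InfMat.continuous_of_locally_bounded {X : Type*} [TopologicalSpace X] {f : X → InfMat}
    (hc : Continuous fun x => (f x).entries)
    (hb : ∀ x₀, ∃ n, ∀ᶠ x in 𝓝 x₀, SuppIn n (f x).entries) : Continuous f := by
  rw [continuous_iff_continuousAt]
  intro x₀
  obtain ⟨n, hn⟩ := hb x₀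
  have h1 : Continuous fun x => pad n (corner n (f x).entries) :=
    (continuous_pad n).comp ((continuous_corner n).comp hc)
  exact h1.continuousAt.congr (hn.mono fun x hx => pad_corner hx)

theorem InfMat.continuous_entries : Continuous InfMat.entries := by
  rw [InfMat.continuous_iff]
  intro n
  refine continuous_matrix fun i j => ?_
  by_cases h : i < n ∧ j < n
  · simp only [pad, h, and_self, dite_true]
    fun_prop
  · simp only [pad, h, dite_false]
    exact continuous_const

theorem InfMat.continuous_frobDist (P : InfMat) : Continuous fun A : InfMat => A.frobDist P := by
  rw [InfMat.continuous_iff]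
  intro n
  obtain ⟨m, hm⟩ := P.exists_suppIn
  have h : ∀ M : Matrix (Fin n) (Fin n) ℝ, (pad n M).frobDist P
      = frobNorm (corner (n + m) (pad n M).entries - corner (n + m) P.entries) := fun M =>
    frobDist_eq ((suppIn_pad n M).mono (by omega)) (hm.mono (by omega))
  simp only [h]
  exact continuous_frobNorm.comp
    (((continuous_corner _).comp (continuous_entries.comp (continuous_pad n))).sub
      continuous_const)

/-- Open subsets of a direct limit inherit the property that continuity can be tested on the finite
stages; for arbitrary subsets this may fail. -/
theorem InfMat.continuousOn_of_isOpen {Y : Type*} [TopologicalSpace Y] {g : InfMat → Y}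
    {T : Set InfMat} (hT : IsOpen T)
    (h : ∀ n M, pad n M ∈ T → ContinuousAt (fun M => g (pad n M)) M) : ContinuousOn g T := by
  rw [continuousOn_open_iff hT]
  intro t ht
  rw [InfMat.isOpen_iff]
  intro n
  rw [isOpen_iff_mem_nhds]
  rintro M ⟨hM, hMt⟩
  exact Filter.inter_mem ((hT.preimage (continuous_pad n)).mem_nhds hM)
    ((h n M hM).preimage_mem_nhds (ht.mem_nhds hMt))

/-! ### Grassmannians -/

/-- For an idempotent the rank is the trace, so the Grassmannian is cut out by polynomial equations
and is closed. -/
theorem mem_grassmannian_iff {d n : ℕ} {A : Matrix (Fin n) (Fin n) ℝ} :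
    A ∈ grassmannian d n ↔ Aᵀ = A ∧ A * A = A ∧ A.trace = d := by
  refine and_congr_right fun _ => and_congr_right fun h => ?_
  rw [← rank_eq_trace_of_idempotent h]
  exact Nat.cast_inj.symm

/-- Infinite matrices which are orthogonal projections of rank `d`. -/
def IsProjOfRank (d : ℕ) (A : Matrix ℕ ℕ ℝ) : Prop :=
  Aᵀ = A ∧ (∀ i j, ∑' k, A i k * A k j = A i j) ∧ ∑' k, A k k = d

/-- The right-hand side does not mention `n`, so a point of `Gr d` can be viewed in any stage that
contains its support. -/
theorem corner_mem_grassmannian_iff {d n : ℕ} {A : Matrix ℕ ℕ ℝ} (hA : SuppIn n A) :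
    corner n A ∈ grassmannian d n ↔ IsProjOfRank d A := by
  have hmul : ∀ i j, ∑' k, A i k * A k j = ∑ k : Fin n, A i k * A k j := fun i j => by
    rw [Fin.sum_univ_eq_sum_range (fun k => A i k * A k j) n]
    exact tsum_eq_sum fun k hk => by rw [hA i k (by simp at hk; omega), zero_mul]
  have htr : ∑' k, A k k = ∑ k : Fin n, A k k := by
    rw [Fin.sum_univ_eq_sum_range (fun k => A k k) n]
    exact tsum_eq_sum fun k hk => hA k k (by simp at hk; omega)
  rw [mem_grassmannian_iff, IsProjOfRank, htr]
  refine and_congr ⟨fun h => ?_, fun h => ?_⟩ (and_congr ⟨fun h i j => ?_, fun h => ?_⟩ Iff.rfl)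
  · ext i j
    by_cases hij : i < n ∧ j < n
    · exact congrFun (congrFun h ⟨i, hij.1⟩) ⟨j, hij.2⟩
    · rw [Matrix.transpose_apply, hA i j (by omega), hA j i (by omega)]
  · ext i j
    exact congrFun (congrFun h i) j
  · rw [hmul]
    by_cases hij : i < n ∧ j < n
    · exact congrFun (congrFun h ⟨i, hij.1⟩) ⟨j, hij.2⟩
    · rw [hA i j (by omega)]
      refine Finset.sum_eq_zero fun k _ => ?_
      by_cases hi : i < n
      · rw [hA k j (by omega), mul_zero]
      · rw [hA i k (by omega), zero_mul]
  · ext i j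
    rw [Matrix.mul_apply]
    exact (hmul i j).symm.trans (h i j)

theorem mem_Gr_iff {d : ℕ} {A : InfMat} : A ∈ Gr d ↔ IsProjOfRank d A.entries := by
  constructor
  · intro h
    obtain ⟨n, M, hM, rfl⟩ := Set.mem_iUnion.1 h
    rw [← corner_mem_grassmannian_iff (InfMat.suppIn_pad n M), InfMat.corner_pad]
    exact hM
  · intro h
    obtain ⟨n, hn⟩ := A.exists_suppIn
    exact Set.mem_iUnion.2 ⟨n, corner n A.entries, (corner_mem_grassmannian_iff hn).2 h,
      InfMat.pad_corner hn⟩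

theorem frobInner_self_of_mem_Gr {d : ℕ} {A : InfMat} (h : A ∈ Gr d) :
    frobInner A.entries A.entries = d := by
  obtain ⟨n, hn⟩ := A.exists_suppIn
  have := mem_grassmannian_iff.1 ((corner_mem_grassmannian_iff hn).2 (mem_Gr_iff.1 h))
  rw [frobInner_eq hn, this.1, this.2.1, this.2.2]

/-- All points of `Gr d` have squared norm `d`, so minimizing the distance from `A` amounts to
maximizing the inner product with `A`. -/
theorem frobDist_sq_of_mem_Gr {d : ℕ} {A Q : InfMat} (hQ : Q ∈ Gr d) :
    A.frobDist Q ^ 2 = frobInner A.entries A.entries - 2 * frobInner A.entries Q.entries + d := by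
  rw [InfMat.frobDist_sq, frobInner_self_of_mem_Gr hQ]

theorem eq_of_frobDist_eq_zero {A B : InfMat} (h : A.frobDist B = 0) : A = B := by
  obtain ⟨a, ha⟩ := A.exists_suppIn
  obtain ⟨b, hb⟩ := B.exists_suppIn
  have ha' := ha.mono (show a ≤ a + b by omega)
  have hb' := hb.mono (show b ≤ a + b by omega)
  rw [InfMat.frobDist_eq ha' hb'] at h
  rw [← InfMat.pad_corner ha', ← InfMat.pad_corner hb', sub_eq_zero.1 (frobNorm_eq_zero h)]

/-- A corner of a projection lies between `0` and `1`, and its trace is at most the rank. -/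
theorem corner_of_mem_Gr {d : ℕ} {R : InfMat} (hR : R ∈ Gr d) (n : ℕ) :
    (corner n R.entries)ᵀ = corner n R.entries ∧
    (∀ v, 0 ≤ v ⬝ᵥ corner n R.entries *ᵥ v) ∧
    (∀ v, v ⬝ᵥ corner n R.entries *ᵥ v ≤ v ⬝ᵥ v) ∧ (corner n R.entries).trace ≤ d := by
  obtain ⟨m, hm⟩ := R.exists_suppIn
  have hnN : n ≤ n + m := by omega
  obtain ⟨h1, h2, h3⟩ := mem_grassmannian_iff.1 ((corner_mem_grassmannian_iff
    (hm.mono (show m ≤ n + m by omega))).2 (mem_Gr_iff.1 hR))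
  set R' := corner (n + m) R.entries with hR'
  have hsub : corner n R.entries = R'.submatrix (Fin.castLE hnN) (Fin.castLE hnN) := rfl
  -- A corner of a projection `T` is the Gram matrix of the first `n` columns of `T`. Applied to
  -- `R'` and to `1 - R'`, this gives both bounds.
  have hgram : ∀ T : Matrix (Fin (n + m)) (Fin (n + m)) ℝ, Tᵀ = T → T * T = T →
      ∀ v : Fin n → ℝ, 0 ≤ v ⬝ᵥ T.submatrix (Fin.castLE hnN) (Fin.castLE hnN) *ᵥ v := by
    intro T hT hTT v
    have e : T.submatrix (Fin.castLE hnN) (Fin.castLE hnN)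
        = (T.submatrix id (Fin.castLE hnN))ᵀ * T.submatrix id (Fin.castLE hnN) := by
      rw [Matrix.transpose_submatrix, hT]
      exact (congrArg (fun S => Matrix.submatrix S (Fin.castLE hnN) (Fin.castLE hnN)) hTT).symm
    rw [e, ← Matrix.mulVec_mulVec, Matrix.dotProduct_mulVec, Matrix.vecMul_transpose]
    exact dotProduct_self_nonneg _
  refine ⟨?_, fun v => hsub ▸ hgram R' h1 h2 v, fun v => ?_, ?_⟩
  · rw [hsub, Matrix.transpose_submatrix, h1]
  · have h4 := hgram (1 - R') (by rw [Matrix.transpose_sub, h1, Matrix.transpose_one])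
      (by simp [Matrix.mul_sub, Matrix.sub_mul, h2]) v
    rw [Matrix.submatrix_sub, Pi.sub_apply, Pi.sub_apply,
      Matrix.submatrix_one _ (Fin.castLE_injective hnN), Matrix.sub_mulVec, Matrix.one_mulVec,
      dotProduct_sub] at h4
    rw [hsub]
    linarith
  · rw [← h3]
    have hd : ∀ k, 0 ≤ R.entries k k := fun k => by
      rw [← (mem_Gr_iff.1 hR).2.1 k k]
      refine tsum_nonneg fun l => ?_
      have : R.entries l k = R.entries k l := congrFun (congrFun (mem_Gr_iff.1 hR).1 k) l
      rw [this]
      exact mul_self_nonneg _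
    calc (corner n R.entries).trace = ∑ k ∈ Finset.range n, R.entries k k :=
          Fin.sum_univ_eq_sum_range (fun k => R.entries k k) n
      _ ≤ ∑ k ∈ Finset.range (n + m), R.entries k k :=
          Finset.sum_le_sum_of_subset_of_nonneg (by simp) fun k _ _ => hd k
      _ = R'.trace := (Fin.sum_univ_eq_sum_range (fun k => R.entries k k) (n + m)).symm

/-- Existence and uniqueness of the closest point. -/
theorem exists_closest_point {d n : ℕ} {A P : InfMat} (hA : SuppIn n A.entries)
    (hPn : SuppIn n P.entries) (hP : P ∈ Gr d) (hAP : A.frobDist P < 1 / 2) :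
    ∃ Q ∈ Gr d, SuppIn n Q.entries ∧ ∀ R ∈ Gr d,
      A.frobDist Q ≤ A.frobDist R ∧ (A.frobDist R ≤ A.frobDist Q → R = Q) := by
  set A' := corner n A.entries with hA'
  set P' := corner n P.entries with hP'
  obtain ⟨hPT, hPP, hPd⟩ := (corner_mem_grassmannian_iff hPn).2 (mem_Gr_iff.1 hP)
  -- `A` need not be symmetric. Inner products with symmetric matrices see only its symmetric part,
  -- which is no farther from `P` than `A` is.
  set As : Matrix (Fin n) (Fin n) ℝ := (1 / 2 : ℝ) • (A' + A'ᵀ) with hAs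
  have hsymm : Asᵀ = As := by
    rw [hAs, Matrix.transpose_smul, Matrix.transpose_add, Matrix.transpose_transpose, add_comm]
  have hdist : frobNorm (As - P') < 1 / 2 := by
    rw [InfMat.frobDist_eq hA hPn] at hAP
    have e : As - P' = (1 / 2 : ℝ) • ((A' - P') + (A' - P')ᵀ) := by
      have hPT' : P'ᵀ = P' := hPT
      rw [hAs, Matrix.transpose_sub, hPT']
      ext i j
      simp
      ring
    rw [e, frobNorm_smul]
    have h1 := frobNorm_add_le (A' - P') (A' - P')ᵀ
    rw [frobNorm_transpose] at h1
    rw [abs_of_pos (by norm_num)]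
    linarith
  obtain ⟨Q', hQT, hQQ, hQd, hQ⟩ := exists_spectral_projection hsymm hPP hPd hdist
  have hQn := InfMat.suppIn_pad n Q'
  have hQGr : InfMat.pad n Q' ∈ Gr d := Set.mem_iUnion.2 ⟨n, Q', ⟨hQT, hQQ, hQd⟩, rfl⟩
  have hinner : ∀ R ∈ Gr d, frobInner A.entries R.entries = (As * corner n R.entries).trace := by
    intro R hR
    have hRT := (corner_of_mem_Gr hR n).1
    have e : (A' * corner n R.entries).trace = (A'ᵀ * corner n R.entries).trace := by
      rw [← Matrix.trace_transpose, Matrix.transpose_mul, hRT, Matrix.trace_mul_comm]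
    rw [frobInner_eq hA, hAs, Matrix.smul_mul, Matrix.add_mul, Matrix.trace_smul,
      Matrix.trace_add, e, smul_eq_mul]
    ring
  refine ⟨InfMat.pad n Q', hQGr, hQn, fun R hR => ?_⟩
  -- A competitor `R` may have larger support than `A`. Its corner is then not a projection in
  -- general, but it satisfies the weaker constraints under which `Q'` is optimal.
  obtain ⟨-, h0, h1, htr⟩ := corner_of_mem_Gr hR n
  obtain ⟨hle, heq⟩ := hQ _ h0 h1 htr
  have eQ := frobDist_sq_of_mem_Gr (A := A) hQGr
  have eR := frobDist_sq_of_mem_Gr (A := A) hR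
  rw [hinner _ hQGr, InfMat.corner_pad] at eQ
  rw [hinner _ hR] at eR
  refine ⟨frobNorm_le_of_sq_le (A := A.entries - (InfMat.pad n Q').entries)
    (B := A.entries - R.entries) ?_, fun h => ?_⟩
  · change A.frobDist _ ^ 2 ≤ A.frobDist _ ^ 2
    linarith
  · have h2 := pow_le_pow_left₀ (InfMat.frobDist_nonneg _ _) h 2
    have h3 := heq (by linarith)
    -- Equality in the maximization gives inner product `d`, so the squared distance is `d - 2 d +
    -- d`.
    have h4 : (InfMat.pad n Q').frobDist R ^ 2 = 0 := by
      rw [frobDist_sq_of_mem_Gr hR, frobInner_self_of_mem_Gr hQGr, frobInner_eq hQn,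
        InfMat.corner_pad, hQT, h3]
      ring
    exact (eq_of_frobDist_eq_zero (by simpa using h4)).symm

theorem isCompact_grassmannian (d n : ℕ) : IsCompact (grassmannian d n) := by
  refine (isCompact_frobNorm_le √d).of_isClosed_subset ?_ fun A hA => ?_
  · have : grassmannian d n = {A : Matrix (Fin n) (Fin n) ℝ | Aᵀ = A} ∩
        ({A | A * A = A} ∩ {A | A.trace = d}) := by
      ext A
      exact mem_grassmannian_iff
    rw [this]
    exact (isClosed_eq (by fun_prop) (by fun_prop)).inter
      ((isClosed_eq (by fun_prop) (by fun_prop)).inter (isClosed_eq (by fun_prop) (by fun_prop)))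
  · have h := mem_grassmannian_iff.1 hA
    refine Real.le_sqrt_of_sq_le ?_
    rw [frobNorm_sq_eq_trace, h.1, h.2.1, h.2.2]

/-! ### The projection to the Grassmannian -/

/-- The points at distance less than `1/2` from `Gr_d`. -/
def nearGr (d : ℕ) : Set InfMat := {A | ∃ P ∈ Gr d, A.frobDist P < 1 / 2}

theorem isOpen_nearGr (d : ℕ) : IsOpen (nearGr d) := by
  have : nearGr d = ⋃ P ∈ Gr d, {A | A.frobDist P < 1 / 2} := by
    ext A
    simp [nearGr]
  rw [this]
  exact isOpen_biUnion fun P _ => isOpen_lt (InfMat.continuous_frobDist P) continuous_const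

open Classical in
/-- The closest point of `Gr_d`. -/
def closestPoint (d : ℕ) (A : InfMat) : InfMat :=
  if h : ∃ Q ∈ Gr d, ∀ R ∈ Gr d, A.frobDist Q ≤ A.frobDist R ∧
    (A.frobDist R ≤ A.frobDist Q → R = Q) then h.choose else A

theorem closestPoint_spec {d : ℕ} {A : InfMat} (hA : A ∈ nearGr d) :
    closestPoint d A ∈ Gr d ∧ ∀ R ∈ Gr d, A.frobDist (closestPoint d A) ≤ A.frobDist R ∧
      (A.frobDist R ≤ A.frobDist (closestPoint d A) → R = closestPoint d A) := by
  have h : ∃ Q ∈ Gr d, ∀ R ∈ Gr d, A.frobDist Q ≤ A.frobDist R ∧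
      (A.frobDist R ≤ A.frobDist Q → R = Q) := by
    obtain ⟨P, hP, hAP⟩ := hA
    obtain ⟨a, ha⟩ := A.exists_suppIn
    obtain ⟨b, hb⟩ := P.exists_suppIn
    obtain ⟨Q, hQ, -, h⟩ := exists_closest_point (ha.mono (show a ≤ a + b by omega))
      (hb.mono (show b ≤ a + b by omega)) hP hAP
    exact ⟨Q, hQ, h⟩
  rw [closestPoint, dif_pos h]
  exact h.choose_spec

/-- The minimizer constructed within the stage `n` is the global one. This bound on supports reduces
continuity of the projection to a finite stage. -/
theorem suppIn_closestPoint {d n : ℕ} {A P : InfMat} (hA : SuppIn n A.entries)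
    (hPn : SuppIn n P.entries) (hP : P ∈ Gr d) (hAP : A.frobDist P < 1 / 2) :
    SuppIn n (closestPoint d A).entries := by
  obtain ⟨Q, hQ, hQn, h⟩ := exists_closest_point hA hPn hP hAP
  have hs := closestPoint_spec (d := d) ⟨P, hP, hAP⟩
  rwa [(h _ hs.1).2 (hs.2 Q hQ).1]

/-- Near a given matrix all closest points lie in one compact `grassmannian d N`, with `N` large
enough to contain a nearby point `P` as well. Being a minimizer there is a closed condition, and the
minimizer is unique. -/
theorem continuousOn_closestPoint (d : ℕ) : ContinuousOn (closestPoint d) (nearGr d) := by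
  refine InfMat.continuousOn_of_isOpen (isOpen_nearGr d) fun n M₀ hM₀ => ?_
  obtain ⟨P, hP, hMP⟩ := hM₀
  obtain ⟨m, hm⟩ := P.exists_suppIn
  set N := n + m with hN
  have hPN : SuppIn N P.entries := hm.mono (by omega)
  have hpN : ∀ M, SuppIn N (InfMat.pad n M).entries := fun M =>
    (InfMat.suppIn_pad n M).mono (by omega)
  have hev : ∀ᶠ M in 𝓝 M₀, (InfMat.pad n M).frobDist P < 1 / 2 :=
    ((InfMat.continuous_frobDist P).comp (InfMat.continuous_pad n)).continuousAt.eventually_lt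
      continuousAt_const hMP
  have hsupp : ∀ M, (InfMat.pad n M).frobDist P < 1 / 2 →
      SuppIn N (closestPoint d (InfMat.pad n M)).entries := fun M hM =>
    suppIn_closestPoint (hpN M) hPN hP hM
  have hc : Continuous fun M : Matrix (Fin n) (Fin n) ℝ => corner N (InfMat.pad n M).entries :=
    (continuous_corner N).comp (InfMat.continuous_entries.comp (InfMat.continuous_pad n))
  have key : Filter.Tendsto (fun M => corner N (closestPoint d (InfMat.pad n M)).entries) (𝓝 M₀)
      (𝓝 (corner N (closestPoint d (InfMat.pad n M₀)).entries)) := by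
    have hG : IsClosed {p : Matrix (Fin n) (Fin n) ℝ × Matrix (Fin N) (Fin N) ℝ |
        ∀ Z ∈ grassmannian d N, frobNorm (corner N (InfMat.pad n p.1).entries - p.2)
          ≤ frobNorm (corner N (InfMat.pad n p.1).entries - Z)} := by
      simp only [Set.ofPred_forall]
      refine isClosed_iInter fun Z => isClosed_iInter fun _ => isClosed_le ?_ ?_
      · exact continuous_frobNorm.comp ((hc.comp continuous_fst).sub continuous_snd)
      · exact continuous_frobNorm.comp ((hc.comp continuous_fst).sub continuous_const)
    have hpadGr : ∀ Z ∈ grassmannian d N, InfMat.pad N Z ∈ Gr d := fun Z hZ =>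
      Set.mem_iUnion.2 ⟨N, Z, hZ, rfl⟩
    refine tendsto_of_isClosed_graph le_rfl (isCompact_grassmannian d N) hG ?_ ?_ ?_
    · filter_upwards [hev] with M hM
      exact (corner_mem_grassmannian_iff (hsupp M hM)).2
        (mem_Gr_iff.1 (closestPoint_spec ⟨P, hP, hM⟩).1)
    · filter_upwards [hev] with M hM Z hZ
      have := ((closestPoint_spec (d := d) ⟨P, hP, hM⟩).2 _ (hpadGr Z hZ)).1
      rw [InfMat.frobDist_eq (hpN M) (hsupp M hM),
        InfMat.frobDist_eq (hpN M) (InfMat.suppIn_pad N Z), InfMat.corner_pad] at this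
      exact this
    · intro Y hY hYmin
      have hs := closestPoint_spec (d := d) ⟨P, hP, hMP⟩
      have h1 := hYmin _ ((corner_mem_grassmannian_iff (hsupp M₀ hMP)).2 (mem_Gr_iff.1 hs.1))
      have h2 := (hs.2 _ (hpadGr Y hY)).2 (by
        rw [InfMat.frobDist_eq (hpN M₀) (hsupp M₀ hMP),
          InfMat.frobDist_eq (hpN M₀) (InfMat.suppIn_pad N Y), InfMat.corner_pad]
        exact h1)
      rw [← h2, InfMat.corner_pad]
  have h3 := ((InfMat.continuous_pad N).tendsto _).comp key
  rw [InfMat.pad_corner (hsupp M₀ hMP)] at h3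
  refine h3.congr' (hev.mono fun M hM => ?_)
  exact InfMat.pad_corner (hsupp M hM)

theorem thickGr_subset_nearGr {d : ℕ} {δ : ℝ} (hδ : δ ≤ 1 / 2) : thickGr d δ ⊆ nearGr d := by
  rintro A (⟨-, hA⟩ | ⟨-, P, hP, hAP⟩)
  · exact ⟨A, hA, by rw [InfMat.frobDist_self]; norm_num⟩
  · exact ⟨P, hP, hAP.trans_le hδ⟩

/-- The closest point projection of a thickening. -/
def grProj {d : ℕ} {δ : ℝ} (hδ : δ ≤ 1 / 2) : C(thickGr d δ, Gr d) where
  toFun A := ⟨closestPoint d A.1, (closestPoint_spec (thickGr_subset_nearGr hδ A.2)).1⟩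
  continuous_toFun :=
    ((continuousOn_closestPoint d).mono (thickGr_subset_nearGr hδ)).domRestrict.subtype_mk _

theorem isClosestPointProjection_grProj {d : ℕ} {δ : ℝ} (hδ : δ ≤ 1 / 2) :
    IsClosestPointProjection (grProj (d := d) hδ) := by
  intro A P
  have hs := closestPoint_spec (thickGr_subset_nearGr hδ A.2)
  constructor
  · intro h
    exact Subtype.ext ((hs.2 P.1 P.2).2 (h (grProj hδ A)))
  · rintro rfl Q
    exact (hs.2 Q.1 Q.2).1

/-! ### Frames with finitely many nonzero rows -/

section Frames

variable {d : ℕ}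

/-- Only the first `n` rows are nonzero. -/
def RowsIn (n : ℕ) (Φ : Matrix ℕ (Fin d) ℝ) : Prop := ∀ r a, n ≤ r → Φ r a = 0

/-- The first `n` rows. -/
def topRows (n : ℕ) (Φ : Matrix ℕ (Fin d) ℝ) : Matrix (Fin n) (Fin d) ℝ :=
  Φ.submatrix Fin.val id

/-- The product `Φᵀ Ψ`. -/
def gram (Φ Ψ : Matrix ℕ (Fin d) ℝ) : Matrix (Fin d) (Fin d) ℝ :=
  fun a b => ∑' k, Φ k a * Ψ k b

/-- The product `A Φ`. -/
def imul (A : Matrix ℕ ℕ ℝ) (Φ : Matrix ℕ (Fin d) ℝ) : Matrix ℕ (Fin d) ℝ :=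
  fun r a => ∑' k, A r k * Φ k a

theorem RowsIn.mono {n m : ℕ} (h : n ≤ m) {Φ : Matrix ℕ (Fin d) ℝ} (hΦ : RowsIn n Φ) :
    RowsIn m Φ := fun r a hr => hΦ r a (h.trans hr)

theorem RowsIn.add {n : ℕ} {Φ Ψ : Matrix ℕ (Fin d) ℝ} (hΦ : RowsIn n Φ) (hΨ : RowsIn n Ψ) :
    RowsIn n (Φ + Ψ) := fun r a hr => by
  rw [Matrix.add_apply, hΦ r a hr, hΨ r a hr, add_zero]

theorem RowsIn.sub {n : ℕ} {Φ Ψ : Matrix ℕ (Fin d) ℝ} (hΦ : RowsIn n Φ) (hΨ : RowsIn n Ψ) :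
    RowsIn n (Φ - Ψ) := fun r a hr => by
  rw [Matrix.sub_apply, hΦ r a hr, hΨ r a hr, sub_zero]

theorem RowsIn.mul {n : ℕ} {Φ : Matrix ℕ (Fin d) ℝ} (hΦ : RowsIn n Φ)
    (g : Matrix (Fin d) (Fin d) ℝ) : RowsIn n (Φ * g) := fun r a hr => by
  rw [Matrix.mul_apply]
  exact Finset.sum_eq_zero fun b _ => by rw [hΦ r b hr, zero_mul]

theorem topRows_mul (n : ℕ) (Φ : Matrix ℕ (Fin d) ℝ) (g : Matrix (Fin d) (Fin d) ℝ) :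
    topRows n (Φ * g) = topRows n Φ * g := rfl

theorem topRows_sub (n : ℕ) (Φ Ψ : Matrix ℕ (Fin d) ℝ) :
    topRows n (Φ - Ψ) = topRows n Φ - topRows n Ψ := rfl

theorem topRows_add (n : ℕ) (Φ Ψ : Matrix ℕ (Fin d) ℝ) :
    topRows n (Φ + Ψ) = topRows n Φ + topRows n Ψ := rfl

theorem corner_mul_transpose (n : ℕ) (Φ Ψ : Matrix ℕ (Fin d) ℝ) :
    corner n (Φ * Ψᵀ) = topRows n Φ * (topRows n Ψ)ᵀ := rfl

theorem RowsIn.suppIn {n : ℕ} {Φ : Matrix ℕ (Fin d) ℝ} (hΦ : RowsIn n Φ) :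
    SuppIn n (Φ * Φᵀ) := fun i j hij => by
  rw [Matrix.mul_apply]
  refine Finset.sum_eq_zero fun b _ => ?_
  rcases hij with h | h
  · rw [hΦ i b h, zero_mul]
  · rw [Matrix.transpose_apply, hΦ j b h, mul_zero]

theorem RowsIn.ext {n : ℕ} {Φ Ψ : Matrix ℕ (Fin d) ℝ} (hΦ : RowsIn n Φ) (hΨ : RowsIn n Ψ)
    (h : topRows n Φ = topRows n Ψ) : Φ = Ψ := by
  ext r a
  by_cases hr : r < n
  · exact congrFun (congrFun h ⟨r, hr⟩) a
  · rw [hΦ r a (by omega), hΨ r a (by omega)]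

theorem gram_eq_of_rowsIn_left {n : ℕ} {Φ : Matrix ℕ (Fin d) ℝ} (hΦ : RowsIn n Φ)
    (Ψ : Matrix ℕ (Fin d) ℝ) : gram Φ Ψ = (topRows n Φ)ᵀ * topRows n Ψ := by
  ext a b
  rw [gram, Matrix.mul_apply, tsum_eq_sum (s := Finset.range n)
    fun k hk => by rw [hΦ k a (by simpa using hk), zero_mul]]
  exact (Fin.sum_univ_eq_sum_range (fun k => Φ k a * Ψ k b) n).symm

theorem gram_transpose (Φ Ψ : Matrix ℕ (Fin d) ℝ) : (gram Φ Ψ)ᵀ = gram Ψ Φ := by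
  ext a b
  simp only [Matrix.transpose_apply, gram, mul_comm]

theorem frobNorm_topRows {n : ℕ} {Φ : Matrix ℕ (Fin d) ℝ} (hΦ : RowsIn n Φ) :
    frobNorm (topRows n Φ) = frobNorm Φ := by
  have hinj : Function.Injective (Prod.map Fin.val id : Fin n × Fin d → ℕ × Fin d) :=
    Function.Injective.prodMap Fin.val_injective Function.injective_id
  rw [frobNorm, frobNorm, ← hinj.tsum_eq (f := fun p : ℕ × Fin d => Φ p.1 p.2 ^ 2)]
  · rfl
  · intro p hp
    have h : p.1 < n := by
      by_contra h
      exact hp (by simp [hΦ p.1 p.2 (by omega)])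
    exact ⟨(⟨p.1, h⟩, p.2), rfl⟩

theorem frobNorm_sq_eq_trace_gram (Φ : Matrix ℕ (Fin d) ℝ) {n : ℕ} (hΦ : RowsIn n Φ) :
    frobNorm Φ ^ 2 = (gram Φ Φ).trace := by
  rw [gram_eq_of_rowsIn_left hΦ, ← frobNorm_sq_eq_trace, frobNorm_topRows hΦ]

theorem imul_apply_eq {n : ℕ} (A : Matrix ℕ ℕ ℝ) {Φ : Matrix ℕ (Fin d) ℝ} (hΦ : RowsIn n Φ)
    (r : ℕ) (a : Fin d) : imul A Φ r a = ∑ k ∈ Finset.range n, A r k * Φ k a :=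
  tsum_eq_sum fun k hk => by rw [hΦ k a (by simpa using hk), mul_zero]

theorem topRows_imul {n : ℕ} (m : ℕ) (A : Matrix ℕ ℕ ℝ) {Φ : Matrix ℕ (Fin d) ℝ}
    (hΦ : RowsIn n Φ) :
    topRows m (imul A Φ) = A.submatrix (Fin.val : Fin m → ℕ) (Fin.val : Fin n → ℕ) *
      topRows n Φ := by
  ext r a
  refine (imul_apply_eq A hΦ r a).trans ?_
  exact (Fin.sum_univ_eq_sum_range (fun k => A r k * Φ k a) n).symm

theorem imul_mul {n : ℕ} (A : Matrix ℕ ℕ ℝ) {Φ : Matrix ℕ (Fin d) ℝ} (hΦ : RowsIn n Φ)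
    (g : Matrix (Fin d) (Fin d) ℝ) : imul A (Φ * g) = imul A Φ * g := by
  ext r a
  rw [imul_apply_eq A (hΦ.mul g), Matrix.mul_apply]
  simp only [imul_apply_eq A hΦ, Matrix.mul_apply, Finset.mul_sum, Finset.sum_mul]
  rw [Finset.sum_comm]
  simp only [mul_assoc]

theorem imul_sub {n : ℕ} (A : Matrix ℕ ℕ ℝ) {Φ Ψ : Matrix ℕ (Fin d) ℝ} (hΦ : RowsIn n Φ)
    (hΨ : RowsIn n Ψ) : imul A (Φ - Ψ) = imul A Φ - imul A Ψ := by
  ext r a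
  rw [imul_apply_eq A (hΦ.sub hΨ), Matrix.sub_apply, imul_apply_eq A hΦ, imul_apply_eq A hΨ,
    ← Finset.sum_sub_distrib]
  simp only [Matrix.sub_apply, mul_sub]

/-- The columns with number less than `k` vanish from row `h k` on. -/
def ColsIn (h : ℕ → ℕ) (A : Matrix ℕ ℕ ℝ) : Prop := ∀ n r k, k < n → h n ≤ r → A r k = 0

/-- The relation `Aᵀ B = c`. -/
def ColGram (A B : Matrix ℕ ℕ ℝ) (c : ℝ) : Prop :=
  ∀ k l, ∑' r, A r k * B r l = if k = l then c else 0

theorem ColsIn.rowsIn_imul {h : ℕ → ℕ} {A : Matrix ℕ ℕ ℝ} (hA : ColsIn h A) {n : ℕ}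
    {Φ : Matrix ℕ (Fin d) ℝ} (hΦ : RowsIn n Φ) : RowsIn (h n) (imul A Φ) := fun r a hr => by
  rw [imul_apply_eq A hΦ]
  exact Finset.sum_eq_zero fun k hk => by rw [hA n r k (by simpa using hk) hr, zero_mul]

/-- Only the first `n` columns of `A` and `B` matter, and those of `A` vanish from row `h n` on, so
`Φᵀ Aᵀ B Ψ` is a product of finite matrices. -/
theorem gram_imul {h : ℕ → ℕ} {A B : Matrix ℕ ℕ ℝ} (hA : ColsIn h A) {c : ℝ}
    (hAB : ColGram A B c) {n : ℕ} {Φ Ψ : Matrix ℕ (Fin d) ℝ}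
    (hΦ : RowsIn n Φ) (hΨ : RowsIn n Ψ) : gram (imul A Φ) (imul B Ψ) = c • gram Φ Ψ := by
  rw [gram_eq_of_rowsIn_left (hA.rowsIn_imul hΦ), topRows_imul _ A hΦ, topRows_imul _ B hΨ,
    gram_eq_of_rowsIn_left hΦ, Matrix.transpose_mul, Matrix.mul_assoc, ← Matrix.mul_assoc _ _
    (topRows n Ψ)]
  have : (A.submatrix (Fin.val : Fin (h n) → ℕ) (Fin.val : Fin n → ℕ))ᵀ *
      B.submatrix (Fin.val : Fin (h n) → ℕ) (Fin.val : Fin n → ℕ) = c • 1 := by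
    ext k l
    rw [Matrix.mul_apply, Matrix.smul_apply, Matrix.one_apply]
    have h1 := hAB k l
    rw [tsum_eq_sum (s := Finset.range (h n))
      fun r hr => by rw [hA n r k k.2 (by simpa using hr), zero_mul]] at h1
    refine (Fin.sum_univ_eq_sum_range (fun r => A r k * B r l) (h n)).trans (h1.trans ?_)
    simp only [Fin.ext_iff]
    split_ifs <;> simp
  rw [this, Matrix.smul_mul, Matrix.one_mul, Matrix.mul_smul]

/-- Gram matrices of sums of two frames in orthogonal subspaces. -/
theorem gram_imul_add_imul {h : ℕ → ℕ} {A B : Matrix ℕ ℕ ℝ} (hA : ColsIn h A) (hB : ColsIn h B)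
    {c : ℝ} (hAA : ColGram A A c) (hBB : ColGram B B (1 - c)) (hAB : ColGram A B 0) {n : ℕ}
    {Φ Ψ Φ' Ψ' : Matrix ℕ (Fin d) ℝ} (hΦ : RowsIn n Φ) (hΨ : RowsIn n Ψ)
    (hΦ' : RowsIn n Φ') (hΨ' : RowsIn n Ψ') :
    gram (imul A Φ + imul B Ψ) (imul A Φ' + imul B Ψ')
      = c • gram Φ Φ' + (1 - c) • gram Ψ Ψ' := by
  have hBA : ColGram B A 0 := fun k l => by
    have := hAB l k
    simp only [mul_comm] at this ⊢
    simpa using this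
  have hl := hA.rowsIn_imul hΦ
  have hl' := hB.rowsIn_imul hΨ
  have e1 := gram_imul hA hAA hΦ hΦ'
  have e2 := gram_imul hA hAB hΦ hΨ'
  have e3 := gram_imul hB hBA hΨ hΦ'
  have e4 := gram_imul hB hBB hΨ hΨ'
  rw [gram_eq_of_rowsIn_left hl] at e1 e2
  rw [gram_eq_of_rowsIn_left hl'] at e3 e4
  rw [gram_eq_of_rowsIn_left (hl.add hl'), topRows_add, topRows_add, Matrix.transpose_add,
    Matrix.add_mul, Matrix.mul_add, Matrix.mul_add, e1, e2, e3, e4]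
  simp

end Frames

/-! ### Approximately compatible systems of frames -/

/-- `x < ε`, or `x = 0` in case `ε = 0`. -/
def Near (ε x : ℝ) : Prop := (ε = 0 ∧ x = 0) ∨ (0 < ε ∧ x < ε)

theorem Near.le {ε x : ℝ} (h : Near ε x) : x ≤ ε := by
  rcases h with ⟨h1, h2⟩ | ⟨-, h2⟩
  · rw [h1, h2]
  · exact h2.le

/-- Convexity keeps the error bound, including its strictness, along the path joining two frame
systems. -/
theorem near_of_sq_convex {ε x a b c : ℝ} (ha0 : 0 ≤ a) (hb0 : 0 ≤ b)
    (ha : Near ε a) (hb : Near ε b) (hc0 : 0 ≤ c) (hc1 : c ≤ 1)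
    (h : x ^ 2 = c * a ^ 2 + (1 - c) * b ^ 2) : Near ε x := by
  rcases ha with ⟨h1, h2⟩ | ⟨h1, h2⟩
  · rcases hb with ⟨-, h4⟩ | ⟨h3, -⟩
    · left
      rw [h2, h4] at h
      exact ⟨h1, by simpa using h⟩
    · exact absurd h1 h3.ne'
  · rcases hb with ⟨h3, -⟩ | ⟨-, h4⟩
    · exact absurd h3 h1.ne'
    · right
      refine ⟨h1, lt_of_pow_lt_pow_left₀ 2 h1.le ?_⟩
      have ea : a ^ 2 < ε ^ 2 := pow_lt_pow_left₀ h2 ha0 (by norm_num)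
      have eb : b ^ 2 < ε ^ 2 := pow_lt_pow_left₀ h4 hb0 (by norm_num)
      rw [h]
      rcases hc0.eq_or_lt with rfl | hc
      · linarith
      · nlinarith

section FrameSystem

variable {X I : Type*} [TopologicalSpace X] {d : ℕ}

theorem continuousOn_imul {C : X → Matrix ℕ ℕ ℝ} {Θ : X → Matrix ℕ (Fin d) ℝ} {S : Set X}
    (hC : Continuous C) (hΘ : ContinuousOn Θ S) (hrow : ∀ x₀, ∃ n, ∀ᶠ x in 𝓝 x₀, RowsIn n (Θ x)) :
    ContinuousOn (fun x => imul (C x) (Θ x)) S := by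
  intro x₀ hx₀
  obtain ⟨n, hn⟩ := hrow x₀
  refine tendsto_pi_nhds.2 fun r => tendsto_pi_nhds.2 fun a => ?_
  have h1 : ContinuousWithinAt (fun x => ∑ k ∈ Finset.range n, C x r k * Θ x k a) S x₀ := by
    refine tendsto_finsetSum _ fun k _ => Filter.Tendsto.mul ?_ ?_
    · exact ((continuous_apply_apply r k).comp hC).continuousWithinAt
    · exact tendsto_pi_nhds.1 (tendsto_pi_nhds.1 (hΘ x₀ hx₀) k) a
  refine ContinuousWithinAt.congr_of_eventuallyEq h1 ?_ (imul_apply_eq _ hn.self_of_nhds r a)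
  filter_upwards [nhdsWithin_le_nhds hn] with x hx
  exact imul_apply_eq _ hx r a

theorem continuousOn_gram {Φ Θ : X → Matrix ℕ (Fin d) ℝ} {S : Set X}
    (hΦ : ContinuousOn Φ S) (hΘ : ContinuousOn Θ S)
    (hrow : ∀ x₀, ∃ n, ∀ᶠ x in 𝓝 x₀, RowsIn n (Φ x)) :
    ContinuousOn (fun x => gram (Φ x) (Θ x)) S := by
  intro x₀ hx₀
  obtain ⟨n, hn⟩ := hrow x₀
  have hgram : ∀ x, RowsIn n (Φ x) → ∀ a b, gram (Φ x) (Θ x) a b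
      = ∑ k ∈ Finset.range n, Φ x k a * Θ x k b := fun x hx a b =>
    tsum_eq_sum fun k hk => by rw [hx k a (by simpa using hk), zero_mul]
  refine tendsto_pi_nhds.2 fun a => tendsto_pi_nhds.2 fun b => ?_
  have h1 : ContinuousWithinAt (fun x => ∑ k ∈ Finset.range n, Φ x k a * Θ x k b) S x₀ :=
    tendsto_finsetSum _ fun k _ => Filter.Tendsto.mul
      (tendsto_pi_nhds.1 (tendsto_pi_nhds.1 (hΦ x₀ hx₀) k) a)
      (tendsto_pi_nhds.1 (tendsto_pi_nhds.1 (hΘ x₀ hx₀) k) b)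
  refine ContinuousWithinAt.congr_of_eventuallyEq h1 ?_ (hgram _ hn.self_of_nhds a b)
  filter_upwards [nhdsWithin_le_nhds hn] with x hx
  exact hgram x hx a b

/-- A system of orthonormal frames `Φ i` over the sets `U i`, such that `Φ i * g i j` is within
distance `ε` of `Φ j`. -/
structure FrameSystem (ε : ℝ) (U : I → Set X) (g : I → I → X → Matrix (Fin d) (Fin d) ℝ)
    (Φ : I → X → Matrix ℕ (Fin d) ℝ) : Prop where
  rows : ∀ x₀, ∃ n, ∀ᶠ x in 𝓝 x₀, ∀ i, RowsIn n (Φ i x)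
  cont : ∀ i, ContinuousOn (Φ i) (U i)
  orth : ∀ i x, x ∈ U i → gram (Φ i x) (Φ i x) = 1
  trans_orth : ∀ i j x, x ∈ U i → x ∈ U j → g i j x * (g i j x)ᵀ = 1
  near : ∀ i j x, x ∈ U i → x ∈ U j → Near ε (frobNorm (Φ i x * g i j x - Φ j x))

variable {ε : ℝ} {U : I → Set X} {g : I → I → X → Matrix (Fin d) (Fin d) ℝ}
  {Φ : I → X → Matrix ℕ (Fin d) ℝ}

theorem FrameSystem.rowsIn (h : FrameSystem ε U g Φ) (x : X) : ∃ n, ∀ i, RowsIn n (Φ i x) := by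
  obtain ⟨n, hn⟩ := h.rows x
  exact ⟨n, hn.self_of_nhds⟩

theorem suppIn_av {n : ℕ} {x : X} (φ : PartitionOfUnity I X) (hΦ : ∀ i, RowsIn n (Φ i x)) :
    SuppIn n (av φ Φ x) := by
  have hconv : Convex ℝ {A | SuppIn n A} := by
    intro A hA B hB a b _ _ _ i j hij
    simp [hA i j hij, hB i j hij]
  exact φ.finsum_smul_mem_convex (g := fun i x => Φ i x * (Φ i x)ᵀ) (Set.mem_univ x)
    (fun i _ => (hΦ i).suppIn) hconv

theorem corner_frame_mem_grassmannian {n : ℕ} {Ψ : Matrix ℕ (Fin d) ℝ} (hn : RowsIn n Ψ)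
    (h : gram Ψ Ψ = 1) : corner n (Ψ * Ψᵀ) ∈ grassmannian d n := by
  rw [gram_eq_of_rowsIn_left hn] at h
  rw [mem_grassmannian_iff, corner_mul_transpose]
  refine ⟨by simp, ?_, ?_⟩
  · rw [Matrix.mul_assoc, ← Matrix.mul_assoc _ (topRows n Ψ), h, Matrix.one_mul]
  · rw [Matrix.trace_mul_comm, h, Matrix.trace_one, Fintype.card_fin]

/-- The projection onto the span of the columns of a frame, as an infinite matrix. -/
def frameProj (Ψ : Matrix ℕ (Fin d) ℝ) (h : ∃ n, RowsIn n Ψ) : InfMat where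
  entries := Ψ * Ψᵀ
  finite_support := h.imp fun _ hn => hn.suppIn

theorem frameProj_mem_Gr {Ψ : Matrix ℕ (Fin d) ℝ} (h : ∃ n, RowsIn n Ψ) (ho : gram Ψ Ψ = 1) :
    frameProj Ψ h ∈ Gr d := by
  obtain ⟨n, hn⟩ := h
  exact mem_Gr_iff.2 ((corner_mem_grassmannian_iff hn.suppIn).1
    (corner_frame_mem_grassmannian hn ho))

/-- Right multiplication by the orthogonal matrix `g i j x` does not change the projection of a
frame, so `frobNorm_proj_sub_proj_le` applies to `Φ i x * g i j x` and `Φ j x`. -/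
theorem FrameSystem.frobNorm_proj_sub_le (h : FrameSystem ε U g Φ) {x : X} {i j : I}
    (hi : x ∈ U i) (hj : x ∈ U j) :
    frobNorm (Φ i x * (Φ i x)ᵀ - Φ j x * (Φ j x)ᵀ)
      ≤ √2 * frobNorm (Φ i x * g i j x - Φ j x) := by
  obtain ⟨n, hn⟩ := h.rowsIn x
  have hg := h.trans_orth i j x hi hj
  have hg' : (g i j x)ᵀ * g i j x = 1 := mul_eq_one_comm.1 hg
  have oi := h.orth i x hi
  have oj := h.orth j x hj
  rw [gram_eq_of_rowsIn_left (hn _)] at oi oj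
  have h1 := frobNorm_proj_sub_proj_le (V := topRows n (Φ i x) * g i j x) (W := topRows n (Φ j x))
    (by rw [Matrix.transpose_mul, Matrix.mul_assoc, ← Matrix.mul_assoc _ (topRows n (Φ i x)), oi,
      Matrix.one_mul, hg']) oj
  rw [← frobNorm_corner ((hn i).suppIn.sub (hn j).suppIn),
    ← frobNorm_topRows (((hn i).mul _).sub (hn j)), corner_sub, corner_mul_transpose,
    corner_mul_transpose, topRows_sub, topRows_mul]
  rwa [Matrix.transpose_mul, Matrix.mul_assoc, ← Matrix.mul_assoc (g i j x), hg,
    Matrix.one_mul] at h1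

/-- The average is a convex combination of projections lying in the open ball around the `j`-th one,
which is convex. For `ε = 0` all these projections coincide, and the ball is replaced by a point. -/
theorem FrameSystem.near_av (h : FrameSystem ε U g Φ) {φ : PartitionOfUnity I X}
    (hφ : φ.IsSubordinate U) {x : X} {j : I} (hj : x ∈ U j) :
    Near (√2 * ε) (frobNorm (av φ Φ x - Φ j x * (Φ j x)ᵀ)) := by
  obtain ⟨n, hn⟩ := h.rowsIn x
  have hmem : ∀ i, φ i x ≠ 0 → x ∈ U i := fun i hi => hφ i (subset_tsupport _ hi)
  have hP := (hn j).suppIn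
  by_cases hε : 0 < ε
  · right
    have hδ : 0 < √2 * ε := by positivity
    refine ⟨hδ, ?_⟩
    have hconv : Convex ℝ {A | frobNorm (corner n A - corner n (Φ j x * (Φ j x)ᵀ)) < √2 * ε} := by
      intro A hA B hB a b ha hb hab
      have hA' : frobNorm (corner n A - corner n (Φ j x * (Φ j x)ᵀ)) < √2 * ε := hA
      have hB' : frobNorm (corner n B - corner n (Φ j x * (Φ j x)ᵀ)) < √2 * ε := hB
      have e : corner n (a • A + b • B) - corner n (Φ j x * (Φ j x)ᵀ)
          = a • (corner n A - corner n (Φ j x * (Φ j x)ᵀ))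
            + b • (corner n B - corner n (Φ j x * (Φ j x)ᵀ)) := by
        ext k l
        simp only [corner, Matrix.sub_apply, Matrix.add_apply, Matrix.smul_apply,
          Matrix.submatrix_apply, smul_eq_mul]
        linear_combination (Φ j x * (Φ j x)ᵀ) k l * hab
      change frobNorm _ < _
      rw [e]
      refine (frobNorm_add_le _ _).trans_lt ?_
      rw [frobNorm_smul, frobNorm_smul, abs_of_nonneg ha, abs_of_nonneg hb]
      have hb1 : b = 1 - a := by linarith
      subst hb1
      rcases ha.eq_or_lt with rfl | ha
      · simpa using hB'
      · nlinarith
    have := φ.finsum_smul_mem_convex (g := fun i x => Φ i x * (Φ i x)ᵀ) (Set.mem_univ x)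
      (fun i hi => ?_) hconv
    · rw [← frobNorm_corner ((suppIn_av φ hn).sub hP), corner_sub]
      exact this
    · change frobNorm _ < _
      rw [← corner_sub, frobNorm_corner ((hn i).suppIn.sub hP)]
      refine (h.frobNorm_proj_sub_le (hmem i hi) hj).trans_lt ?_
      rcases h.near i j x (hmem i hi) hj with ⟨h0, -⟩ | ⟨-, h2⟩
      · exact absurd h0 hε.ne'
      · exact mul_lt_mul_of_pos_left h2 (by positivity)
  · have hε0 : ε = 0 := by
      rcases h.near j j x hj hj with ⟨h0, -⟩ | ⟨h1, -⟩
      · exact h0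
      · exact absurd h1 hε
    left
    refine ⟨by rw [hε0, mul_zero], ?_⟩
    have := φ.finsum_smul_mem_convex (g := fun i x => Φ i x * (Φ i x)ᵀ) (Set.mem_univ x)
      (fun i hi => ?_) (convex_singleton (Φ j x * (Φ j x)ᵀ))
    · have e : av φ Φ x = Φ j x * (Φ j x)ᵀ := this
      rw [e, sub_self, frobNorm_zero]
    · have h1 := h.frobNorm_proj_sub_le (hmem i hi) hj
      have h2 : frobNorm (Φ i x * g i j x - Φ j x) = 0 := by
        rcases h.near i j x (hmem i hi) hj with ⟨-, h0⟩ | ⟨h1, -⟩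
        · exact h0
        · exact absurd h1 hε
      rw [h2, mul_zero, ← frobNorm_corner ((hn i).suppIn.sub hP)] at h1
      have h3 := sub_eq_zero.1 (frobNorm_eq_zero (le_antisymm h1 (frobNorm_nonneg _)))
      rw [Set.mem_singleton_iff]
      have := congrArg InfMat.entries (congrArg (InfMat.pad n) h3)
      have ei := congrArg InfMat.entries
        (InfMat.pad_corner (n := n) (A := frameProj (Φ i x) ⟨n, hn i⟩) (hn i).suppIn)
      have ej := congrArg InfMat.entries
        (InfMat.pad_corner (n := n) (A := frameProj (Φ j x) ⟨n, hn j⟩) (hn j).suppIn)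
      exact ei.symm.trans (this.trans ej)

theorem FrameSystem.continuous_av (h : FrameSystem ε U g Φ) (hU : ∀ i, IsOpen (U i))
    {φ : PartitionOfUnity I X} (hφ : φ.IsSubordinate U) : Continuous (av φ Φ) := by
  refine hφ.continuous_finsum_smul hU (g := fun i x => Φ i x * (Φ i x)ᵀ) fun i => ?_
  rw [continuousOn_iff_continuous_domRestrict]
  have := continuousOn_iff_continuous_domRestrict.1 (h.cont i)
  exact this.matrix_mul this.matrix_transpose

/-- The averaged projection of a system of frames, as a map to the thickened Grassmannian. -/
def FrameSystem.avMap (h : FrameSystem ε U g Φ) (hU : ∀ i, IsOpen (U i))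
    {φ : PartitionOfUnity I X} (hφ : φ.IsSubordinate U) : C(X, thickGr d (√2 * ε)) where
  toFun x := ⟨⟨av φ Φ x, (h.rowsIn x).imp fun _ hn => suppIn_av φ hn⟩, by
    obtain ⟨j, hj⟩ := φ.exists_pos (Set.mem_univ x)
    have hjU : x ∈ U j := hφ j (subset_tsupport _ hj.ne')
    have hrow := (h.rowsIn x).imp fun n (hn : ∀ i, RowsIn n (Φ i x)) => hn j
    have hGr := frameProj_mem_Gr hrow (h.orth j x hjU)
    rcases h.near_av hφ hjU with ⟨h0, h1⟩ | ⟨h0, h1⟩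
    · refine Or.inl ⟨h0, ?_⟩
      have e : (⟨av φ Φ x, (h.rowsIn x).imp fun _ hn => suppIn_av φ hn⟩ : InfMat)
          = frameProj (Φ j x) hrow := eq_of_frobDist_eq_zero h1
      rwa [e]
    · exact Or.inr ⟨h0, _, hGr, h1⟩⟩
  continuous_toFun := by
    refine Continuous.subtype_mk ?_ _
    refine InfMat.continuous_of_locally_bounded (h.continuous_av hU hφ) fun x₀ => ?_
    obtain ⟨n, hn⟩ := h.rows x₀
    exact ⟨n, hn.mono fun x hx => suppIn_av φ hx⟩

theorem FrameSystem.avMap_entries (h : FrameSystem ε U g Φ) (hU : ∀ i, IsOpen (U i))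
    {φ : PartitionOfUnity I X} (hφ : φ.IsSubordinate U) (x : X) :
    (h.avMap hU hφ x).1.entries = av φ Φ x := rfl

/-- Two systems of frames with the same transition functions, combined by an isometry. -/
theorem FrameSystem.combine (hΦ : FrameSystem ε U g Φ) {Ψ : I → X → Matrix ℕ (Fin d) ℝ}
    (hΨ : FrameSystem ε U g Ψ) {h : ℕ → ℕ} {A B : X → Matrix ℕ ℕ ℝ} {c : X → ℝ}
    (hA : ∀ x, ColsIn h (A x)) (hB : ∀ x, ColsIn h (B x)) (hAc : Continuous A) (hBc : Continuous B)
    (hc0 : ∀ x, 0 ≤ c x) (hc1 : ∀ x, c x ≤ 1)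
    (hAA : ∀ x, ColGram (A x) (A x) (c x)) (hBB : ∀ x, ColGram (B x) (B x) (1 - c x))
    (hAB : ∀ x, ColGram (A x) (B x) 0) :
    FrameSystem ε U g fun i x => imul (A x) (Φ i x) + imul (B x) (Ψ i x) where
  rows x₀ := by
    obtain ⟨n, hn⟩ := hΦ.rows x₀
    obtain ⟨m, hm⟩ := hΨ.rows x₀
    refine ⟨h (n + m), ?_⟩
    filter_upwards [hn, hm] with x hx hx' i
    exact ((hA x).rowsIn_imul ((hx i).mono (by omega))).add
      ((hB x).rowsIn_imul ((hx' i).mono (by omega)))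
  cont i := by
    have key : ∀ {C : X → Matrix ℕ ℕ ℝ} {Θ : I → X → Matrix ℕ (Fin d) ℝ}, Continuous C →
        FrameSystem ε U g Θ → ContinuousOn (fun x => imul (C x) (Θ i x)) (U i) :=
      fun hC hΘ => continuousOn_imul hC (hΘ.cont i)
        fun x => (hΘ.rows x).imp fun _ hn => hn.mono fun _ hx => hx i
    exact (key hAc hΦ).add (key hBc hΨ)
  orth i x hx := by
    obtain ⟨n, hn⟩ := hΦ.rowsIn x
    obtain ⟨m, hm⟩ := hΨ.rowsIn x
    have hn' := (hn i).mono (show n ≤ n + m by omega)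
    have hm' := (hm i).mono (show m ≤ n + m by omega)
    rw [gram_imul_add_imul (hA x) (hB x) (hAA x) (hBB x) (hAB x) hn' hm' hn' hm',
      hΦ.orth i x hx, hΨ.orth i x hx, ← add_smul]
    simp
  trans_orth := hΦ.trans_orth
  near i j x hi hj := by
    obtain ⟨n, hn⟩ := hΦ.rowsIn x
    obtain ⟨m, hm⟩ := hΨ.rowsIn x
    have hn' := fun i => (hn i).mono (show n ≤ n + m by omega)
    have hm' := fun i => (hm i).mono (show m ≤ n + m by omega)
    -- The isometries act on the left and `g` on the right, so the errors of the two systems combine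
    -- just as the frames do; their squared norms add with weights `c` and `1 - c`.
    have e : (imul (A x) (Φ i x) + imul (B x) (Ψ i x)) * g i j x
        - (imul (A x) (Φ j x) + imul (B x) (Ψ j x))
        = imul (A x) (Φ i x * g i j x - Φ j x) + imul (B x) (Ψ i x * g i j x - Ψ j x) := by
      rw [imul_sub _ ((hn i).mul _) (hn j), imul_sub _ ((hm i).mul _) (hm j), imul_mul _ (hn i),
        imul_mul _ (hm i), Matrix.add_mul]
      abel
    have rΦ := ((hn' i).mul (g i j x)).sub (hn' j)
    have rΨ := ((hm' i).mul (g i j x)).sub (hm' j)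
    refine near_of_sq_convex (frobNorm_nonneg _) (frobNorm_nonneg _)
      (hΦ.near i j x hi hj) (hΨ.near i j x hi hj) (hc0 x) (hc1 x) ?_
    rw [e, frobNorm_sq_eq_trace_gram _ (((hA x).rowsIn_imul rΦ).add ((hB x).rowsIn_imul rΨ)),
      gram_imul_add_imul (hA x) (hB x) (hAA x) (hBB x) (hAB x) rΦ rΨ rΦ rΨ,
      frobNorm_sq_eq_trace_gram _ rΦ, frobNorm_sq_eq_trace_gram _ rΨ, Matrix.trace_add,
      Matrix.trace_smul, Matrix.trace_smul]
    rfl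

theorem FrameSystem.comp {Y : Type*} [TopologicalSpace Y] (h : FrameSystem ε U g Φ) {p : Y → X}
    (hp : Continuous p) :
    FrameSystem ε (fun i => p ⁻¹' U i) (fun i j y => g i j (p y)) fun i y => Φ i (p y) where
  rows y₀ := by
    obtain ⟨n, hn⟩ := h.rows (p y₀)
    exact ⟨n, hp.continuousAt.eventually hn⟩
  cont i := (h.cont i).comp hp.continuousOn fun _ hy => hy
  orth i y hy := h.orth i (p y) hy
  trans_orth i j y hi hj := h.trans_orth i j (p y) hi hj
  near i j y hi hj := h.near i j (p y) hi hj

end FrameSystem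

/-! ### A path of isometries from the identity to a shift -/

section Rotation

/-- The rotation in the plane of the coordinates `p` and `q`. -/
def rot (c s : ℝ) (p q : ℕ) (v : ℕ → ℝ) : ℕ → ℝ := fun r =>
  if r = p then c * v p - s * v q else if r = q then s * v p + c * v q else v r

/-- The composition of the rotations in the planes `(k, σ k)` for `k < m`. -/
def rots (c s : ℝ) (σ : ℕ → ℕ) : ℕ → (ℕ → ℝ) → ℕ → ℝ
  | 0, v => v
  | m + 1, v => rots c s σ m (rot c s m (σ m) v)

theorem sum_rot_mul_rot {c s : ℝ} (hcs : c ^ 2 + s ^ 2 = 1) {p q N : ℕ} (hpq : p ≠ q) (hp : p < N)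
    (hq : q < N) (v w : ℕ → ℝ) :
    ∑ r ∈ Finset.range N, rot c s p q v r * rot c s p q w r = ∑ r ∈ Finset.range N, v r * w r := by
  have hp' : p ∈ Finset.range N := by simpa using hp
  have hq' : q ∈ (Finset.range N).erase p := by simpa [hpq.symm] using hq
  rw [← Finset.add_sum_erase _ _ hp', ← Finset.add_sum_erase _ _ hp',
    ← Finset.add_sum_erase _ _ hq', ← Finset.add_sum_erase _ _ hq']
  have hrest : ∀ r ∈ ((Finset.range N).erase p).erase q,
      rot c s p q v r * rot c s p q w r = v r * w r := fun r hr => by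
    simp only [Finset.mem_erase] at hr
    simp [rot, hr.1, hr.2.1]
  rw [Finset.sum_congr rfl hrest]
  simp only [rot, if_true, hpq.symm, if_false]
  linear_combination (v p * w p + v q * w q) * hcs

theorem sum_rots_mul_rots {c s : ℝ} (hcs : c ^ 2 + s ^ 2 = 1) {σ : ℕ → ℕ} (hσ : ∀ k, k < σ k)
    {N : ℕ} : ∀ (m : ℕ), (∀ k < m, σ k < N) → ∀ v w : ℕ → ℝ,
    ∑ r ∈ Finset.range N, rots c s σ m v r * rots c s σ m w r
      = ∑ r ∈ Finset.range N, v r * w r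
  | 0, _, v, w => rfl
  | m + 1, hm, v, w => by
    have h1 := hm m (Nat.lt_succ_self m)
    exact (sum_rots_mul_rots hcs hσ m (fun k hk => hm k (hk.trans (Nat.lt_succ_self m))) _ _).trans
      (sum_rot_mul_rot hcs (hσ m).ne ((hσ m).trans h1) h1 v w)

theorem rots_eq_zero {c s : ℝ} {σ : ℕ → ℕ} (hσ : ∀ k, k < σ k) {N : ℕ} :
    ∀ (m : ℕ), (∀ k < m, σ k < N) → ∀ v : ℕ → ℝ, (∀ r, N ≤ r → v r = 0) →
      ∀ r, N ≤ r → rots c s σ m v r = 0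
  | 0, _, v, hv => hv
  | m + 1, hm, v, hv => by
    have h1 := hm m (Nat.lt_succ_self m)
    have h2 := hσ m
    refine rots_eq_zero hσ m (fun k hk => hm k (hk.trans (Nat.lt_succ_self m))) _ fun r hr => ?_
    rw [rot, if_neg (by omega), if_neg (by omega), hv r hr]

theorem rot_single_of_ne (c s : ℝ) {p q k : ℕ} (hp : k ≠ p) (hq : k ≠ q) :
    rot c s p q (Pi.single k 1) = Pi.single k 1 := by
  ext r
  simp only [rot, Pi.single_apply, hp.symm, hq.symm, if_false]
  split_ifs <;> simp_all

/-- The rotation of highest index acts first, and those in planes `(l, σ l)` with `l > k` fix `e_k`.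
So the `k`-th column stabilizes, which gives the infinite product a meaning. -/
theorem rots_single_of_lt (c s : ℝ) {σ : ℕ → ℕ} (hσ : ∀ k, k < σ k) {k m : ℕ} (hkm : k < m) :
    rots c s σ m (Pi.single k 1) = rots c s σ (k + 1) (Pi.single k 1) := by
  induction m, hkm using Nat.le_induction with
  | base => rfl
  | succ m hm ih =>
    have h := hσ m
    change rots c s σ m (rot c s m (σ m) (Pi.single k 1)) = _
    rw [rot_single_of_ne c s (by omega) (by omega), ih]

theorem rots_one_zero (σ : ℕ → ℕ) : ∀ (m : ℕ) (v : ℕ → ℝ), rots 1 0 σ m v = v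
  | 0, _ => rfl
  | m + 1, v => by
    rw [rots, rots_one_zero σ m]
    ext r
    simp only [rot, one_mul, zero_mul, sub_zero, zero_add]
    split_ifs with h1 h2
    · rw [h1]
    · rw [h2]
    · rfl

/-- The quarter turn in the plane `(k, σ k)` sends `e_k` to `e_{σ k}`. The remaining planes `(m, σ
m)` with `m < k` do not contain `e_{σ k}`, since `m < σ k` and `σ m < σ k`. -/
theorem rots_zero_one_single {σ : ℕ → ℕ} (hσ : ∀ k, k < σ k) (hmono : StrictMono σ) (k : ℕ) :
    rots 0 1 σ (k + 1) (Pi.single k 1) = Pi.single (σ k) 1 := by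
  have h1 : rot 0 1 k (σ k) (Pi.single k 1) = Pi.single (σ k) 1 := by
    have := (hσ k).ne
    ext r
    simp only [rot, Pi.single_apply, this.symm, if_true, if_false]
    split_ifs <;> simp_all
  rw [rots, h1]
  have h2 : ∀ m ≤ k, rots 0 1 σ m (Pi.single (σ k) 1) = Pi.single (σ k) 1 := by
    intro m
    induction m with
    | zero => intro _; rfl
    | succ m ih =>
      intro hm
      have h3 := hmono (show m < k by omega)
      have h4 := hσ k
      rw [rots, rot_single_of_ne 0 1 (by omega) (by omega), ih (by omega)]
  exact h2 k le_rfl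

theorem continuous_rots {X : Type*} [TopologicalSpace X] {c s : X → ℝ} (hc : Continuous c)
    (hs : Continuous s) (σ : ℕ → ℕ) : ∀ (m : ℕ) {v : X → ℕ → ℝ}, Continuous v →
      Continuous fun x => rots (c x) (s x) σ m (v x)
  | 0, _, hv => hv
  | m + 1, v, hv => by
    refine continuous_rots hc hs σ m (v := fun x => rot (c x) (s x) m (σ m) (v x)) ?_
    refine continuous_pi fun r => ?_
    unfold rot
    split_ifs <;> fun_prop

/-- The isometry whose restriction to the first `m` coordinates is `rots c s σ m`. -/
def rotMatrix (c s : ℝ) (σ : ℕ → ℕ) : Matrix ℕ ℕ ℝ :=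
  fun r k => rots c s σ (k + 1) (Pi.single k 1) r

/-- The isometry which moves the coordinate `k` to `σ k`. -/
def shiftMatrix (σ : ℕ → ℕ) : Matrix ℕ ℕ ℝ := fun r k => if r = σ k then 1 else 0

theorem colsIn_rotMatrix (c s : ℝ) {σ h : ℕ → ℕ} (hσ : ∀ k, k < σ k)
    (hh : ∀ n k, k < n → σ k < h n) : ColsIn h (rotMatrix c s σ) := by
  intro n r k hk hr
  refine rots_eq_zero hσ (N := h n) (k + 1) (fun l hl => hh n l (by omega)) _ (fun i hi => ?_) r hr
  have h1 := hσ k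
  have h2 := hh n k hk
  exact Pi.single_eq_of_ne (by omega) _

theorem colsIn_shiftMatrix {σ h : ℕ → ℕ} (hh : ∀ n k, k < n → σ k < h n) :
    ColsIn h (shiftMatrix σ) := by
  intro n r k hk hr
  have := hh n k hk
  exact if_neg (by omega)

/-- Any two columns are images of basis vectors under one finite product of rotations, which
preserves inner products. -/
theorem colGram_rotMatrix {c s : ℝ} (hcs : c ^ 2 + s ^ 2 = 1) {σ : ℕ → ℕ} (hσ : ∀ k, k < σ k)
    (hmono : StrictMono σ) : ColGram (rotMatrix c s σ) (rotMatrix c s σ) 1 := by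
  intro k l
  set m := max k l + 1 with hm
  have hN : ∀ j < m, σ j < σ m := fun j hj => hmono hj
  have hcols : ∀ j < m, ∀ r, rotMatrix c s σ r j = rots c s σ m (Pi.single j 1) r := fun j hj r => by
    rw [rotMatrix, rots_single_of_lt c s hσ hj]
  simp only [hcols k (by omega), hcols l (by omega)]
  have hkN : k < σ m := (show k < m by omega).trans (hσ m)
  rw [tsum_eq_sum (s := Finset.range (σ m)), sum_rots_mul_rots hcs hσ m hN]
  · simp only [Pi.single_apply, ite_mul, one_mul, zero_mul]
    rw [Finset.sum_ite_eq' (Finset.range (σ m)) k, if_pos (by simpa using hkN)]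
  · intro r hr
    rw [rots_eq_zero hσ m hN _ (fun i hi => Pi.single_eq_of_ne (by omega) _) r (by simpa using hr),
      zero_mul]

theorem colGram_smul_shiftMatrix (a b c : ℝ) {σ τ : ℕ → ℕ}
    (h : ∀ k l, a * b * (if σ k = τ l then 1 else 0) = if k = l then c else 0) :
    ColGram (a • shiftMatrix σ) (b • shiftMatrix τ) c := by
  intro k l
  rw [tsum_eq_single (σ k)]
  · rw [← h k l]
    simp only [Matrix.smul_apply, shiftMatrix, smul_eq_mul]
    ring_nf
    simp
  · intro r hr
    simp [shiftMatrix, hr]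

theorem rotMatrix_one_zero (σ : ℕ → ℕ) : rotMatrix 1 0 σ = 1 := by
  ext r k
  rw [rotMatrix, rots_one_zero, Pi.single_apply, Matrix.one_apply]

theorem rotMatrix_zero_one {σ : ℕ → ℕ} (hσ : ∀ k, k < σ k) (hmono : StrictMono σ) :
    rotMatrix 0 1 σ = shiftMatrix σ := by
  ext r k
  rw [rotMatrix, rots_zero_one_single hσ hmono, Pi.single_apply, shiftMatrix]

theorem continuous_rotMatrix {X : Type*} [TopologicalSpace X] {c s : X → ℝ} (hc : Continuous c)
    (hs : Continuous s) (σ : ℕ → ℕ) : Continuous fun x => rotMatrix (c x) (s x) σ :=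
  continuous_matrix fun r k =>
    (continuous_apply r).comp (continuous_rots hc hs σ (k + 1) continuous_const)

theorem imul_one {d : ℕ} (Φ : Matrix ℕ (Fin d) ℝ) : imul 1 Φ = Φ := by
  ext r a
  rw [imul, tsum_eq_single r (fun k hk => by rw [Matrix.one_apply_ne hk.symm, zero_mul]),
    Matrix.one_apply_eq, one_mul]

theorem imul_zero {d : ℕ} (Φ : Matrix ℕ (Fin d) ℝ) : imul 0 Φ = 0 := by
  ext r a
  simp [imul]

end Rotation

/-! ### Homotopies of averaged maps -/

section Homotopy

variable {X I : Type*} [TopologicalSpace X] {d : ℕ} {ε : ℝ} {U : I → Set X}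
  {g : I → I → X → Matrix (Fin d) (Fin d) ℝ} {Φ Ψ : I → X → Matrix ℕ (Fin d) ℝ}

theorem finsum_mix_eq_one (φ ψ : PartitionOfUnity I X) (t : ℝ) (x : X) :
    ∑ᶠ i, ((1 - t) * φ i x + t * ψ i x) = 1 := by
  have h1 := φ.locallyFinite.point_finite x
  have h2 := ψ.locallyFinite.point_finite x
  rw [finsum_add_distrib (h1.subset fun i hi => right_ne_zero_of_mul hi)
    (h2.subset fun i hi => right_ne_zero_of_mul hi), ← mul_finsum, ← mul_finsum,
    φ.sum_eq_one (Set.mem_univ _), ψ.sum_eq_one (Set.mem_univ _)]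
  ring

/-- The linear path between two partitions of unity. -/
def mixPartition (φ ψ : PartitionOfUnity I X) : PartitionOfUnity I (unitInterval × X) where
  toFun i := ⟨fun p => (1 - (p.1 : ℝ)) * φ i p.2 + p.1 * ψ i p.2, by fun_prop⟩
  locallyFinite' := by
    intro p
    obtain ⟨s, hs, hsf⟩ := φ.locallyFinite p.2
    obtain ⟨t, ht, htf⟩ := ψ.locallyFinite p.2
    refine ⟨Prod.snd ⁻¹' (s ∩ t), continuous_snd.continuousAt.preimage_mem_nhds
      (Filter.inter_mem hs ht), (hsf.union htf).subset ?_⟩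
    rintro i ⟨q, hq, hqs, hqt⟩
    by_cases h : φ i q.2 = 0
    · by_cases h' : ψ i q.2 = 0
      · exact absurd (by simp [h, h']) hq
      · exact Or.inr ⟨q.2, h', hqt⟩
    · exact Or.inl ⟨q.2, h, hqs⟩
  nonneg' i p := add_nonneg (mul_nonneg (sub_nonneg.2 p.1.2.2) (φ.nonneg i p.2))
    (mul_nonneg p.1.2.1 (ψ.nonneg i p.2))
  sum_eq_one' p _ := finsum_mix_eq_one φ ψ p.1 p.2
  sum_le_one' p := (finsum_mix_eq_one φ ψ p.1 p.2).le

theorem mixPartition_apply (φ ψ : PartitionOfUnity I X) (i : I) (p : unitInterval × X) :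
    mixPartition φ ψ i p = (1 - (p.1 : ℝ)) * φ i p.2 + p.1 * ψ i p.2 := rfl

theorem isSubordinate_mixPartition {φ ψ : PartitionOfUnity I X} (hφ : φ.IsSubordinate U)
    (hψ : ψ.IsSubordinate U) :
    (mixPartition φ ψ).IsSubordinate fun i => Prod.snd ⁻¹' U i := by
  intro i
  have hclosed : IsClosed (Prod.snd ⁻¹' (tsupport (φ i) ∪ tsupport (ψ i)) :
      Set (unitInterval × X)) :=
    ((isClosed_tsupport _).union (isClosed_tsupport _)).preimage continuous_snd
  refine (closure_minimal ?_ hclosed).trans (Set.preimage_mono (Set.union_subset (hφ i) (hψ i)))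
  intro p hp
  by_contra h
  have h1 : p.2 ∉ tsupport (φ i) := fun h' => h (Or.inl h')
  have h2 : p.2 ∉ tsupport (ψ i) := fun h' => h (Or.inr h')
  exact hp (by rw [mixPartition_apply, image_eq_zero_of_notMem_tsupport h1,
    image_eq_zero_of_notMem_tsupport h2]; simp)

/-- A system of frames over `[0,1] × X` gives a homotopy. -/
theorem FrameSystem.homotopic_of_path (hU : ∀ i, IsOpen (U i)) {φ ψ : PartitionOfUnity I X}
    (hφ : φ.IsSubordinate U) (hψ : ψ.IsSubordinate U)
    {G : I → I → unitInterval × X → Matrix (Fin d) (Fin d) ℝ}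
    {Θ : I → unitInterval × X → Matrix ℕ (Fin d) ℝ}
    (h : FrameSystem ε (fun i => Prod.snd ⁻¹' U i) G Θ) {f₀ f₁ : C(X, thickGr d (√2 * ε))}
    (h₀ : ∀ x, (f₀ x).1.entries = av φ (fun i x => Θ i (0, x)) x)
    (h₁ : ∀ x, (f₁ x).1.entries = av ψ (fun i x => Θ i (1, x)) x) : f₀.Homotopic f₁ := by
  refine ⟨⟨h.avMap (fun i => (hU i).preimage continuous_snd) (isSubordinate_mixPartition hφ hψ),
    fun x => Subtype.ext (InfMat.ext ?_), fun x => Subtype.ext (InfMat.ext ?_)⟩⟩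
  · rw [h₀]
    refine (h.avMap_entries _ _ _).trans ?_
    simp only [av, mixPartition_apply]
    simp
  · rw [h₁]
    refine (h.avMap_entries _ _ _).trans ?_
    simp only [av, mixPartition_apply]
    simp

theorem FrameSystem.homotopic_partition (h : FrameSystem ε U g Φ) (hU : ∀ i, IsOpen (U i))
    {φ ψ : PartitionOfUnity I X} (hφ : φ.IsSubordinate U) (hψ : ψ.IsSubordinate U) :
    (h.avMap hU hφ).Homotopic (h.avMap hU hψ) :=
  (h.comp continuous_snd).homotopic_of_path hU hφ hψ (fun _ => rfl) fun _ => rfl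

theorem FrameSystem.imul (h : FrameSystem ε U g Φ) {b : ℕ → ℕ} {A : X → Matrix ℕ ℕ ℝ}
    (hA : ∀ x, ColsIn b (A x)) (hAc : Continuous A) (hAA : ∀ x, ColGram (A x) (A x) 1) :
    FrameSystem ε U g fun i x => imul (A x) (Φ i x) := by
  have := h.combine h (A := A) (B := fun _ => 0) (c := fun _ => 1) hA (fun _ _ _ _ _ _ => rfl) hAc
    continuous_const (fun _ => zero_le_one) (fun _ => le_rfl) hAA
    (fun _ k l => by simp) (fun _ k l => by simp)
  simpa only [imul_zero, add_zero] using this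

section Shift

variable {σ τ b : ℕ → ℕ}

theorem colGram_shiftMatrix (hmono : StrictMono σ) :
    ColGram (shiftMatrix σ) (shiftMatrix σ) 1 := by
  simpa using colGram_smul_shiftMatrix 1 1 1 (σ := σ) (τ := σ) fun k l => by
    simp [hmono.injective.eq_iff]

theorem FrameSystem.shift (h : FrameSystem ε U g Φ) (hmono : StrictMono σ)
    (hb : ∀ n k, k < n → σ k < b n) :
    FrameSystem ε U g fun i x => ApproxBundle.imul (shiftMatrix σ) (Φ i x) :=
  h.imul (A := fun _ => shiftMatrix σ) (fun _ => colsIn_shiftMatrix hb) continuous_const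
    fun _ => colGram_shiftMatrix hmono

/-- Rotating with cosine `√(1 - t)` and sine `√t` joins the identity to the shift. The support bound
`b` is uniform in `t`, as the direct limit topology requires. -/
theorem FrameSystem.homotopic_shift (h : FrameSystem ε U g Φ) (hU : ∀ i, IsOpen (U i))
    {φ : PartitionOfUnity I X} (hφ : φ.IsSubordinate U) (hσ : ∀ k, k < σ k)
    (hmono : StrictMono σ) (hb : ∀ n k, k < n → σ k < b n) :
    (h.avMap hU hφ).Homotopic ((h.shift hmono hb).avMap hU hφ) := by
  have hsys := (h.comp (continuous_snd : Continuous (Prod.snd : unitInterval × X → X))).imul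
    (A := fun p => rotMatrix √(1 - (p.1 : ℝ)) √(p.1 : ℝ) σ) (b := b)
    (fun p => colsIn_rotMatrix _ _ hσ hb)
    (continuous_rotMatrix (by fun_prop) (by fun_prop) σ)
    (fun p => colGram_rotMatrix (by
      rw [Real.sq_sqrt (sub_nonneg.2 p.1.2.2), Real.sq_sqrt p.1.2.1]; ring) hσ hmono)
  refine hsys.homotopic_of_path hU hφ hφ (fun x => ?_) fun x => ?_
  · simp [FrameSystem.avMap_entries, rotMatrix_one_zero, imul_one]
  · simp [FrameSystem.avMap_entries, rotMatrix_zero_one hσ hmono]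

/-- Once the two systems occupy orthogonal coordinate subspaces, the combinations with weights `√(1
- t)` and `√t` stay orthonormal. -/
theorem FrameSystem.homotopic_rotate (hΦ : FrameSystem ε U g Φ) (hΨ : FrameSystem ε U g Ψ)
    (hU : ∀ i, IsOpen (U i)) {φ : PartitionOfUnity I X} (hφ : φ.IsSubordinate U)
    (hσ : StrictMono σ) (hτ : StrictMono τ) (hdisj : ∀ k l, σ k ≠ τ l)
    (hbσ : ∀ n k, k < n → σ k < b n) (hbτ : ∀ n k, k < n → τ k < b n) :
    ((hΦ.shift hσ hbσ).avMap hU hφ).Homotopic ((hΨ.shift hτ hbτ).avMap hU hφ) := by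
  have hsmul : ∀ {ρ : ℕ → ℕ} (a : ℝ), (∀ n k, k < n → ρ k < b n) →
      ColsIn b (a • shiftMatrix ρ) := fun a hρ n r k hk hr => by
    rw [Matrix.smul_apply, colsIn_shiftMatrix hρ n r k hk hr, smul_zero]
  have hself : ∀ {ρ : ℕ → ℕ} (a c : ℝ), StrictMono ρ → a * a = c →
      ColGram (a • shiftMatrix ρ) (a • shiftMatrix ρ) c := fun a c hρ hac =>
    colGram_smul_shiftMatrix _ _ _ fun k l => by simp [hρ.injective.eq_iff, hac]
  have hsys := (hΦ.comp (continuous_snd : Continuous (Prod.snd : unitInterval × X → X))).combine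
    (hΨ.comp continuous_snd) (h := b)
    (A := fun p => √(1 - (p.1 : ℝ)) • shiftMatrix σ) (B := fun p => √(p.1 : ℝ) • shiftMatrix τ)
    (c := fun p => 1 - (p.1 : ℝ)) (fun p => hsmul _ hbσ) (fun p => hsmul _ hbτ)
    (by fun_prop) (by fun_prop) (fun p => sub_nonneg.2 p.1.2.2)
    (fun p => sub_le_self _ p.1.2.1)
    (fun p => hself _ _ hσ (Real.mul_self_sqrt (sub_nonneg.2 p.1.2.2)))
    (fun p => hself _ _ hτ (by rw [Real.mul_self_sqrt p.1.2.1]; ring))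
    (fun p => colGram_smul_shiftMatrix _ _ _ fun k l => by simp [hdisj k l])
  refine hsys.homotopic_of_path hU hφ hφ (fun x => ?_) fun x => ?_
  · simp [FrameSystem.avMap_entries, imul_zero]
  · simp [FrameSystem.avMap_entries, imul_zero]

end Shift

/-- The homotopy class of the averaged map depends neither on the partition of unity nor on the
system of frames with given transition functions. -/
theorem FrameSystem.homotopic (hΦ : FrameSystem ε U g Φ) (hΨ : FrameSystem ε U g Ψ)
    (hU : ∀ i, IsOpen (U i)) {φ ψ : PartitionOfUnity I X} (hφ : φ.IsSubordinate U)
    (hψ : ψ.IsSubordinate U) : (hΦ.avMap hU hφ).Homotopic (hΨ.avMap hU hψ) := by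
  -- Odd coordinates for `Φ`, positive even ones for `Ψ`. The shift `2 * k` would fix `0`, whereas
  -- the rotations need `k < σ k`.
  have hσ : StrictMono fun k : ℕ => 2 * k + 1 := fun a b h => by simp only; omega
  have hτ : StrictMono fun k : ℕ => 2 * k + 2 := fun a b h => by simp only; omega
  have hbσ : ∀ n k : ℕ, k < n → 2 * k + 1 < 2 * n + 2 := fun n k h => by omega
  have hbτ : ∀ n k : ℕ, k < n → 2 * k + 2 < 2 * n + 2 := fun n k h => by omega
  refine ContinuousMap.Homotopic.trans ?_ (hΨ.homotopic_partition hU hφ hψ)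
  refine (hΦ.homotopic_shift hU hφ (fun k => by omega) hσ hbσ).trans ?_
  refine ContinuousMap.Homotopic.trans ?_
    (hΨ.homotopic_shift hU hφ (fun k => by omega) hτ hbτ).symm
  exact hΦ.homotopic_rotate hΨ hU hφ hσ hτ (fun k l => by omega) hbσ hbτ

end Homotopy

/-! ### The local trivialization of a cochain -/

section Block

variable {I : Type*} {d : ℕ}

/-- The row which has number `a` in the block `j`. -/
def rowIndex (ι : I ↪ ℕ) (p : I × Fin d) : ℕ := d * ι p.1 + p.2

/-- The frame consisting of the blocks `w j • Y j`. -/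
def blockFrame (ι : I ↪ ℕ) (w : I → ℝ) (Y : I → Matrix (Fin d) (Fin d) ℝ) :
    Matrix ℕ (Fin d) ℝ :=
  fun r b => ∑ᶠ p : I × Fin d, if r = d * ι p.1 + (p.2 : ℕ) then w p.1 * Y p.1 p.2 b else 0

variable (ι : I ↪ ℕ) (w : I → ℝ) (Y Z : I → Matrix (Fin d) (Fin d) ℝ)

theorem rowIndex_injective : Function.Injective (rowIndex ι : I × Fin d → ℕ) := by
  rintro ⟨i, a⟩ ⟨j, b⟩ h
  have hd : 0 < d := a.pos
  have h1 : ι i = ι j := by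
    have := congrArg (· / d) h
    simpa [rowIndex, Nat.mul_add_div hd, Nat.div_eq_of_lt a.2, Nat.div_eq_of_lt b.2] using this
  have h2 : (a : ℕ) = b := by
    simp only [rowIndex, h1] at h
    omega
  rw [ι.injective h1, Fin.ext h2]

theorem blockFrame_rowIndex (p : I × Fin d) (b : Fin d) :
    blockFrame ι w Y (rowIndex ι p) b = w p.1 * Y p.1 p.2 b := by
  rw [blockFrame, finsum_eq_single _ p]
  · exact if_pos rfl
  · intro q hq
    exact if_neg fun h => hq (rowIndex_injective ι h).symm

theorem blockFrame_eq_zero {r : ℕ} (hr : r ∉ Set.range (rowIndex ι : I × Fin d → ℕ)) (b : Fin d) :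
    blockFrame ι w Y r b = 0 := by
  rw [blockFrame]
  refine (finsum_congr fun p => if_neg fun h => hr ⟨p, h.symm⟩).trans finsum_zero

theorem blockFrame_mul (g : Matrix (Fin d) (Fin d) ℝ) :
    blockFrame ι w Y * g = blockFrame ι w fun j => Y j * g := by
  ext r b
  rw [Matrix.mul_apply]
  by_cases hr : r ∈ Set.range (rowIndex ι : I × Fin d → ℕ)
  · obtain ⟨p, rfl⟩ := hr
    simp only [blockFrame_rowIndex, Matrix.mul_apply, Finset.mul_sum, mul_assoc]
  · simp only [blockFrame_eq_zero ι _ _ hr, zero_mul, Finset.sum_const_zero]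

theorem blockFrame_sub :
    blockFrame ι w Y - blockFrame ι w Z = blockFrame ι w fun j => Y j - Z j := by
  ext r b
  rw [Matrix.sub_apply]
  by_cases hr : r ∈ Set.range (rowIndex ι : I × Fin d → ℕ)
  · obtain ⟨p, rfl⟩ := hr
    simp only [blockFrame_rowIndex, Matrix.sub_apply, mul_sub]
  · simp only [blockFrame_eq_zero ι _ _ hr, sub_zero]

theorem rowsIn_blockFrame {s : Finset I} (hs : ∀ j, j ∉ s → w j = 0) :
    RowsIn (s.sup (fun j => d * ι j) + d) (blockFrame ι w Y) := by
  intro r b hr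
  by_cases hr' : r ∈ Set.range (rowIndex ι : I × Fin d → ℕ)
  · obtain ⟨p, rfl⟩ := hr'
    rw [blockFrame_rowIndex, hs, zero_mul]
    intro hp
    have h1 := Finset.le_sup (f := fun j => d * ι j) hp
    have h2 := p.2.2
    simp only [rowIndex] at hr h1
    omega
  · exact blockFrame_eq_zero ι _ _ hr' b

theorem gram_blockFrame {s : Finset I} (hs : ∀ j, j ∉ s → w j = 0) :
    gram (blockFrame ι w Y) (blockFrame ι w Z) = ∑ j ∈ s, w j ^ 2 • ((Y j)ᵀ * Z j) := by
  ext a b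
  rw [gram, ← (rowIndex_injective (d := d) ι).tsum_eq
    (f := fun k => blockFrame ι w Y k a * blockFrame ι w Z k b),
    tsum_eq_sum (s := s ×ˢ (Finset.univ : Finset (Fin d)))]
  · rw [Finset.sum_product, Matrix.sum_apply]
    refine Finset.sum_congr rfl fun j _ => ?_
    simp only [blockFrame_rowIndex, Matrix.smul_apply, Matrix.mul_apply, Matrix.transpose_apply,
      smul_eq_mul, Finset.mul_sum]
    exact Finset.sum_congr rfl fun c _ => by ring
  · intro p hp
    have : p.1 ∉ s := by simpa using hp
    rw [blockFrame_rowIndex, hs _ this, zero_mul, zero_mul]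
  · intro r hr
    by_contra h
    exact hr (by simp only [blockFrame_eq_zero ι w Y h, zero_mul])

end Block

section Cochain

variable {B I : Type*} [TopologicalSpace B] {U : I → Set B} {d : ℕ} {ε : ℝ}

theorem Cochain.val_of_mem (Ω : Cochain U d) {i j : I} {y : B} (h : y ∈ U j ∩ U i) :
    Ω.val i j y = Ω.map i j ⟨y, h⟩ := dif_pos h

theorem Cochain.val_transpose (Ω : Cochain U d) {i j : I} {y : B} (hi : y ∈ U i) (hj : y ∈ U j) :
    (Ω.val i j y)ᵀ = Ω.val j i y := by
  rw [Ω.val_of_mem ⟨hj, hi⟩, Ω.val_of_mem ⟨hi, hj⟩, Ω.symm j i y hj hi,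
    Matrix.UnitaryGroup.inv_val, Matrix.star_eq_conjTranspose,
    Matrix.conjTranspose_eq_transpose_of_trivial]

theorem Cochain.val_mul_transpose (Ω : Cochain U d) {i j : I} {y : B} (hi : y ∈ U i)
    (hj : y ∈ U j) : Ω.val i j y * (Ω.val i j y)ᵀ = 1 := by
  rw [Ω.val_of_mem ⟨hj, hi⟩]
  exact (Matrix.mem_orthogonalGroup_iff _ _).1 (Ω.map i j ⟨y, hj, hi⟩).2

theorem Cochain.continuousOn_val (Ω : Cochain U d) (i j : I) :
    ContinuousOn (Ω.val i j) (U j ∩ U i) := by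
  rw [continuousOn_iff_continuous_domRestrict]
  refine (continuous_subtype_val.comp (Ω.map i j).continuous).congr fun y => ?_
  exact (Ω.val_of_mem y.2).symm

theorem Cochain.IsApproxCocycle.near {Ω : Cochain U d} (h : Ω.IsApproxCocycle ε) {i j k : I}
    {y : B} (hi : y ∈ U i) (hj : y ∈ U j) (hk : y ∈ U k) :
    Near ε (frobNorm (Ω.val i j y * Ω.val j k y - Ω.val i k y)) :=
  h.imp (fun h => ⟨h.1, by rw [h.2 i j k y hi hj hk, sub_self, frobNorm_zero]⟩)
    fun h => ⟨h.1, h.2 i j k y hi hj hk⟩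

/-- A weighted mean of squared errors obeys the same bound; here the weights will be the values of
the partition of unity. -/
theorem near_of_sq_eq_sum {x : ℝ} {s : Finset I} {w a : I → ℝ} (hw : ∀ j ∈ s, 0 < w j)
    (hsum : ∑ j ∈ s, w j = 1) (ha0 : ∀ j, 0 ≤ a j) (ha : ∀ j ∈ s, Near ε (a j))
    (h : x ^ 2 = ∑ j ∈ s, w j * a j ^ 2) : Near ε x := by
  have hne : s.Nonempty := by
    rw [Finset.nonempty_iff_ne_empty]
    rintro rfl
    simp at hsum
  obtain ⟨j₀, hj₀⟩ := hne
  rcases ha j₀ hj₀ with ⟨h0, -⟩ | ⟨h0, -⟩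
  · refine Or.inl ⟨h0, ?_⟩
    have : ∑ j ∈ s, w j * a j ^ 2 = 0 := Finset.sum_eq_zero fun j hj => by
      rcases ha j hj with ⟨-, h1⟩ | ⟨h1, -⟩
      · simp [h1]
      · exact absurd h0 h1.ne'
    rw [this] at h
    simpa using h
  · refine Or.inr ⟨h0, lt_of_pow_lt_pow_left₀ 2 h0.le ?_⟩
    rw [h]
    calc ∑ j ∈ s, w j * a j ^ 2 < ∑ j ∈ s, w j * ε ^ 2 := by
          refine Finset.sum_lt_sum_of_nonempty ⟨j₀, hj₀⟩ fun j hj => ?_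
          rcases ha j hj with ⟨h1, -⟩ | ⟨-, h1⟩
          · exact absurd h1 h0.ne'
          · exact mul_lt_mul_of_pos_left (pow_lt_pow_left₀ h1 (ha0 j) (by norm_num)) (hw j hj)
      _ = ε ^ 2 := by rw [← Finset.sum_mul, hsum, one_mul]

theorem triv_eq_blockFrame (φ : PartitionOfUnity I B) (ι : I ↪ ℕ) (Ω : Cochain U d) (i : I)
    (y : B) : triv φ ι Ω i y = blockFrame ι (fun j => √(φ j y)) fun j => (Ω.val i j y)ᵀ := rfl

/-- The local trivializations of an approximate cocycle form a system of frames. -/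
theorem Cochain.IsApproxCocycle.frameSystem_triv {Ω : Cochain U d} (h : Ω.IsApproxCocycle ε)
    (hU : ∀ i, IsOpen (U i)) {φ : PartitionOfUnity I B} (hφ : φ.IsSubordinate U) (ι : I ↪ ℕ) :
    FrameSystem ε U Ω.val (triv φ ι Ω) := by
  have hs : ∀ y, ∀ j, j ∉ φ.finsupport y → √(φ j y) = 0 := fun y j hj => by
    have : φ j y = 0 := by simpa [PartitionOfUnity.mem_finsupport] using hj
    rw [this, Real.sqrt_zero]
  have hmem : ∀ y, ∀ j ∈ φ.finsupport y, 0 < φ j y ∧ y ∈ U j := fun y j hj => by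
    have : φ j y ≠ 0 := by simpa [PartitionOfUnity.mem_finsupport] using hj
    exact ⟨(φ.nonneg j y).lt_of_ne' this, hφ j (subset_tsupport _ this)⟩
  refine ⟨fun y₀ => ?_, fun i y₀ hy₀ => ?_, fun i y hi => ?_,
    fun i j y hi hj => Ω.val_mul_transpose hi hj, fun i j y hi hj => ?_⟩
  · refine ⟨(φ.fintsupport y₀).sup (fun j => d * ι j) + d, ?_⟩
    filter_upwards [φ.eventually_finsupport_subset y₀] with y hy i
    rw [triv_eq_blockFrame]
    exact rowsIn_blockFrame ι _ _ fun j hj => hs y j fun h => hj (hy h)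
  · refine tendsto_pi_nhds.2 fun r => tendsto_pi_nhds.2 fun b => ?_
    change ContinuousWithinAt (fun y => triv φ ι Ω i y r b) (U i) y₀
    by_cases hr : r ∈ Set.range (rowIndex ι : I × Fin d → ℕ)
    · obtain ⟨⟨j, a⟩, rfl⟩ := hr
      simp only [triv_eq_blockFrame, blockFrame_rowIndex]
      -- The extension of `Ω.val` by zero may jump at the boundary of `U j`, but outside the closed
      -- support of `φ j` the block vanishes in a whole neighbourhood.
      by_cases hj : y₀ ∈ tsupport (φ j)
      · have hc := (Ω.continuousOn_val i j).continuousAt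
          (((hU j).inter (hU i)).mem_nhds ⟨hφ j hj, hy₀⟩)
        have hc' : ContinuousAt (fun y => (Ω.val i j y)ᵀ a b) y₀ :=
          (continuous_apply_apply b a).continuousAt.comp hc
        exact ((φ j).continuous.sqrt.continuousAt.mul hc').continuousWithinAt
      · have hz : ∀ᶠ y in 𝓝 y₀, φ j y = 0 := notMem_tsupport_iff_eventuallyEq.1 hj
        refine (continuousAt_const (y := (0 : ℝ))).congr ?_ |>.continuousWithinAt
        filter_upwards [hz] with y hy
        rw [hy, Real.sqrt_zero, zero_mul]
    · simp only [triv_eq_blockFrame, blockFrame_eq_zero ι _ _ hr]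
      exact continuousWithinAt_const
  · rw [triv_eq_blockFrame, gram_blockFrame ι _ _ _ (hs y)]
    have : ∀ j ∈ φ.finsupport y, √(φ j y) ^ 2 • ((Ω.val i j y)ᵀᵀ * (Ω.val i j y)ᵀ)
        = φ j y • (1 : Matrix (Fin d) (Fin d) ℝ) := fun j hj => by
      rw [Matrix.transpose_transpose, Ω.val_mul_transpose hi (hmem y j hj).2,
        Real.sq_sqrt (φ.nonneg j y)]
    rw [Finset.sum_congr rfl this, ← Finset.sum_smul, φ.sum_finsupport (Set.mem_univ y), one_smul]
  -- After transposition, the `k`-th block of `Φ i * Ω i j - Φ j` is `√(φ k)` times the cocycle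
  -- defect of the triple `(j, i, k)`.
  · refine near_of_sq_eq_sum (s := φ.finsupport y) (w := fun k => φ k y)
      (a := fun k => frobNorm (Ω.val j i y * Ω.val i k y - Ω.val j k y))
      (fun k hk => (hmem y k hk).1) (φ.sum_finsupport (Set.mem_univ y))
      (fun k => frobNorm_nonneg _) (fun k hk => h.near hj hi (hmem y k hk).2) ?_
    rw [triv_eq_blockFrame, triv_eq_blockFrame, blockFrame_mul, blockFrame_sub,
      frobNorm_sq_eq_trace_gram _ (rowsIn_blockFrame ι _ _ (hs y)),
      gram_blockFrame ι _ _ _ (hs y), Matrix.trace_sum]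
    refine Finset.sum_congr rfl fun k _ => ?_
    rw [Matrix.trace_smul, ← frobNorm_sq_eq_trace, Real.sq_sqrt (φ.nonneg k y), smul_eq_mul,
      ← frobNorm_transpose, Matrix.transpose_sub, Matrix.transpose_mul, Matrix.transpose_transpose,
      Matrix.transpose_transpose, Ω.val_transpose hi hj]

end Cochain

/-! ### Frames of a nearby projection -/

section PolarFrame

variable {d : ℕ}

/-- The orthonormal frame of the range of `Q` closest to the frame `Φ`. -/
def polarFrame (Q : Matrix ℕ ℕ ℝ) (Φ : Matrix ℕ (Fin d) ℝ) : Matrix ℕ (Fin d) ℝ :=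
  imul Q Φ * invSqrt (gram Φ (imul Q Φ))

theorem SuppIn.rowsIn_polarFrame {n : ℕ} {Q : Matrix ℕ ℕ ℝ} (hQ : SuppIn n Q)
    (Φ : Matrix ℕ (Fin d) ℝ) : RowsIn n (polarFrame Q Φ) := by
  refine RowsIn.mul (fun r a hr => ?_) _
  simp [imul, hQ r _ (Or.inl hr)]

theorem polarFrame_spec {n : ℕ} {Q : Matrix ℕ ℕ ℝ} {Φ : Matrix ℕ (Fin d) ℝ} (hQ : SuppIn n Q)
    (hΦ : RowsIn n Φ) (hproj : IsProjOfRank d Q) (ho : gram Φ Φ = 1)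
    (hlt : frobNorm (Φ * Φᵀ - Q) < 1) :
    (gram Φ (imul Q Φ)).PosDef ∧ gram (polarFrame Q Φ) (polarFrame Q Φ) = 1 ∧
    polarFrame Q Φ * (polarFrame Q Φ)ᵀ = Q ∧
    frobNorm (Φ - polarFrame Q Φ) ≤ frobNorm (Φ * Φᵀ - Q) := by
  obtain ⟨hQT, hQQ, hQd⟩ := (corner_mem_grassmannian_iff hQ).2 hproj
  have hΨ := hQ.rowsIn_polarFrame Φ
  have e1 : topRows n (imul Q Φ) = corner n Q * topRows n Φ := topRows_imul n Q hΦ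
  have e2 : gram Φ (imul Q Φ) = (topRows n Φ)ᵀ * (corner n Q * topRows n Φ) := by
    rw [gram_eq_of_rowsIn_left hΦ, e1]
  have e3 : topRows n (polarFrame Q Φ) = corner n Q * topRows n Φ *
      invSqrt ((topRows n Φ)ᵀ * (corner n Q * topRows n Φ)) := by
    rw [polarFrame, topRows_mul, e1, e2]
  rw [gram_eq_of_rowsIn_left hΦ] at ho
  rw [← frobNorm_corner (hΦ.suppIn.sub hQ), corner_sub, corner_mul_transpose] at hlt ⊢
  obtain ⟨h1, h2, h3, h4⟩ := polar_frame ho hQT hQQ (by simpa using hQd) hlt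
  rw [← e3] at h2 h3 h4
  refine ⟨e2 ▸ h1, ?_, ?_, ?_⟩
  · rw [gram_eq_of_rowsIn_left hΨ, h2]
  · have hs := hΨ.suppIn
    ext i j
    by_cases hij : i < n ∧ j < n
    · exact congrFun (congrFun h3 ⟨i, hij.1⟩) ⟨j, hij.2⟩
    · rw [hs i j (by omega), hQ i j (by omega)]
  · rwa [← frobNorm_topRows (hΦ.sub hΨ), topRows_sub]

/-- This is the source of exact cocycles: `Φᵀ (Ψ Ψᵀ) Θ = Φᵀ (Φ Φᵀ) Θ = Φᵀ Θ`. -/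
theorem gram_mul_gram {n : ℕ} {Φ Ψ Θ : Matrix ℕ (Fin d) ℝ} (hΦ : RowsIn n Φ) (hΨ : RowsIn n Ψ)
    (ho : gram Φ Φ = 1) (h : Φ * Φᵀ = Ψ * Ψᵀ) : gram Φ Ψ * gram Ψ Θ = gram Φ Θ := by
  have h' := congrArg (corner n) h
  rw [corner_mul_transpose, corner_mul_transpose] at h'
  rw [gram_eq_of_rowsIn_left hΦ] at ho
  rw [gram_eq_of_rowsIn_left hΦ, gram_eq_of_rowsIn_left hΦ, gram_eq_of_rowsIn_left hΨ,
    Matrix.mul_assoc, ← Matrix.mul_assoc (topRows n Ψ), ← h', ← Matrix.mul_assoc,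
    ← Matrix.mul_assoc, ho, Matrix.one_mul]

theorem mul_gram {n : ℕ} {Φ Ψ : Matrix ℕ (Fin d) ℝ} (hΦ : RowsIn n Φ) (hΨ : RowsIn n Ψ)
    (ho : gram Ψ Ψ = 1) (h : Φ * Φᵀ = Ψ * Ψᵀ) : Φ * gram Φ Ψ = Ψ := by
  have h' := congrArg (corner n) h
  rw [corner_mul_transpose, corner_mul_transpose] at h'
  refine (hΦ.mul _).ext hΨ ?_
  rw [gram_eq_of_rowsIn_left hΨ] at ho
  rw [topRows_mul, gram_eq_of_rowsIn_left hΦ, ← Matrix.mul_assoc, h', Matrix.mul_assoc, ho,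
    Matrix.mul_one]

/-- Replacing frames by nearby frames does not change the transition matrices much. -/
theorem frobNorm_sub_gram_le {n : ℕ} {Φ Φ' Ψ Ψ' : Matrix ℕ (Fin d) ℝ} (hΦ : RowsIn n Φ)
    (hΦ' : RowsIn n Φ') (hΨ : RowsIn n Ψ) (hΨ' : RowsIn n Ψ') (ho : gram Φ Φ = 1)
    (hΨo : gram Ψ' Ψ' = 1) (O : Matrix (Fin d) (Fin d) ℝ) :
    frobNorm (O - gram Ψ Ψ') ≤
      frobNorm (Φ * O - Φ') + frobNorm (Φ' - Ψ') + frobNorm (Φ - Ψ) := by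
  rw [gram_eq_of_rowsIn_left hΦ] at ho
  rw [gram_eq_of_rowsIn_left hΨ'] at hΨo
  rw [gram_eq_of_rowsIn_left hΨ, ← frobNorm_topRows ((hΦ.mul O).sub hΦ'),
    ← frobNorm_topRows (hΦ'.sub hΨ'), ← frobNorm_topRows (hΦ.sub hΨ), topRows_sub, topRows_sub,
    topRows_sub, topRows_mul]
  set a := topRows n Φ
  set a' := topRows n Φ'
  set b := topRows n Ψ
  set b' := topRows n Ψ'
  -- A telescoping sum, arranged so that each difference is multiplied by the adjoint of an
  -- isometry, which does not increase the norm.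
  have e : O - bᵀ * b' = aᵀ * (a * O - a') + (aᵀ * (a' - b') + (b'ᵀ * (a - b))ᵀ) := by
    rw [Matrix.transpose_mul, Matrix.transpose_transpose, Matrix.transpose_sub, Matrix.mul_sub,
      Matrix.mul_sub, Matrix.sub_mul, ← Matrix.mul_assoc, ho, Matrix.one_mul]
    abel
  rw [e, add_assoc]
  refine (frobNorm_add_le _ _).trans (add_le_add (frobNorm_transpose_mul_le ho _) ?_)
  refine (frobNorm_add_le _ _).trans (add_le_add (frobNorm_transpose_mul_le ho _) ?_)
  rw [frobNorm_transpose]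
  exact frobNorm_transpose_mul_le hΨo _

end PolarFrame

/-! ### From a nearby family of projections to an exact cocycle -/

section Straighten

variable {X I : Type*} [TopologicalSpace X] {d : ℕ} {ε : ℝ} {U : I → Set X}
  {g : I → I → X → Matrix (Fin d) (Fin d) ℝ} {Φ : I → X → Matrix ℕ (Fin d) ℝ}
  {Q : X → Matrix ℕ ℕ ℝ}

/-- A continuous family of projections of rank `d` close to the projections given by a system of
frames. -/
structure NearbyProjection (U : I → Set X) (Φ : I → X → Matrix ℕ (Fin d) ℝ)
    (Q : X → Matrix ℕ ℕ ℝ) : Prop where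
  continuous : Continuous Q
  suppIn : ∀ x n, (∀ i, RowsIn n (Φ i x)) → SuppIn n (Q x)
  isProj : ∀ x, IsProjOfRank d (Q x)
  near : ∀ i x, x ∈ U i → frobNorm (Φ i x * (Φ i x)ᵀ - Q x) < 1

theorem FrameSystem.polarFrame_spec (hΦ : FrameSystem ε U g Φ) (hQ : NearbyProjection U Φ Q)
    {i : I} {x : X} (hi : x ∈ U i) :
    (gram (Φ i x) (ApproxBundle.imul (Q x) (Φ i x))).PosDef ∧
    gram (polarFrame (Q x) (Φ i x)) (polarFrame (Q x) (Φ i x)) = 1 ∧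
    polarFrame (Q x) (Φ i x) * (polarFrame (Q x) (Φ i x))ᵀ = Q x ∧
    frobNorm (Φ i x - polarFrame (Q x) (Φ i x)) ≤ frobNorm (Φ i x * (Φ i x)ᵀ - Q x) := by
  obtain ⟨n, hn⟩ := hΦ.rowsIn x
  exact ApproxBundle.polarFrame_spec (hQ.suppIn x n hn) (hn i) (hQ.isProj x) (hΦ.orth i x hi)
    (hQ.near i x hi)

theorem FrameSystem.polarFrame_proj_eq (hΦ : FrameSystem ε U g Φ) (hQ : NearbyProjection U Φ Q)
    {i j : I} {x : X} (hi : x ∈ U i) (hj : x ∈ U j) :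
    polarFrame (Q x) (Φ i x) * (polarFrame (Q x) (Φ i x))ᵀ
      = polarFrame (Q x) (Φ j x) * (polarFrame (Q x) (Φ j x))ᵀ :=
  (hΦ.polarFrame_spec hQ hi).2.2.1.trans (hΦ.polarFrame_spec hQ hj).2.2.1.symm

theorem FrameSystem.rows_polarFrame (hΦ : FrameSystem ε U g Φ) (hQ : NearbyProjection U Φ Q)
    (x₀ : X) : ∃ n, ∀ᶠ x in 𝓝 x₀, ∀ i, RowsIn n (polarFrame (Q x) (Φ i x)) := by
  obtain ⟨n, hn⟩ := hΦ.rows x₀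
  exact ⟨n, hn.mono fun x hx i => (hQ.suppIn x n hx).rowsIn_polarFrame _⟩

theorem FrameSystem.continuousOn_polarFrame (hΦ : FrameSystem ε U g Φ)
    (hQ : NearbyProjection U Φ Q) (i : I) :
    ContinuousOn (fun x => polarFrame (Q x) (Φ i x)) (U i) := by
  have hrow : ∀ x₀, ∃ n, ∀ᶠ x in 𝓝 x₀, RowsIn n (Φ i x) := fun x₀ =>
    (hΦ.rows x₀).imp fun _ hn => hn.mono fun _ hx => hx i
  have h1 := continuousOn_imul hQ.continuous (hΦ.cont i) hrow
  have h2 := continuousOn_gram (hΦ.cont i) h1 hrow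
  have h3 := continuousOn_invSqrt.comp h2 fun x hx => (hΦ.polarFrame_spec hQ hx).1
  rw [continuousOn_iff_continuous_domRestrict] at h1 h3 ⊢
  exact h1.matrix_mul h3

theorem FrameSystem.gram_polarFrame_mul (hΦ : FrameSystem ε U g Φ) (hQ : NearbyProjection U Φ Q)
    {i j k : I} {x : X} (hi : x ∈ U i) (hj : x ∈ U j) :
    gram (polarFrame (Q x) (Φ i x)) (polarFrame (Q x) (Φ j x)) *
      gram (polarFrame (Q x) (Φ j x)) (polarFrame (Q x) (Φ k x))
      = gram (polarFrame (Q x) (Φ i x)) (polarFrame (Q x) (Φ k x)) := by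
  obtain ⟨n, hn⟩ := hΦ.rows_polarFrame hQ x
  exact gram_mul_gram (hn.self_of_nhds i) (hn.self_of_nhds j) (hΦ.polarFrame_spec hQ hi).2.1
    (hΦ.polarFrame_proj_eq hQ hi hj)

/-- The exact cocycle of a continuous family of projections. -/
def FrameSystem.straighten (hΦ : FrameSystem ε U g Φ) (hQ : NearbyProjection U Φ Q) :
    Cochain U d where
  map i j :=
    { toFun := fun y => ⟨gram (polarFrame (Q y) (Φ i y)) (polarFrame (Q y) (Φ j y)), by
        rw [Matrix.mem_orthogonalGroup_iff, gram_transpose,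
          hΦ.gram_polarFrame_mul hQ y.2.2 y.2.1, (hΦ.polarFrame_spec hQ y.2.2).2.1]⟩
      continuous_toFun := by
        refine Continuous.subtype_mk ?_ _
        have := continuousOn_gram ((hΦ.continuousOn_polarFrame hQ i).mono
          (Set.inter_subset_right (s := U j)))
          ((hΦ.continuousOn_polarFrame hQ j).mono (Set.inter_subset_left (t := U i)))
          fun x₀ => (hΦ.rows_polarFrame hQ x₀).imp fun _ hn => hn.mono fun _ hx => hx i
        exact continuousOn_iff_continuous_domRestrict.1 this }
  symm i j y hi hj := by
    apply Subtype.ext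
    rw [Matrix.UnitaryGroup.inv_val, Matrix.star_eq_conjTranspose,
      Matrix.conjTranspose_eq_transpose_of_trivial]
    exact (gram_transpose _ _).symm

theorem FrameSystem.straighten_val (hΦ : FrameSystem ε U g Φ) (hQ : NearbyProjection U Φ Q)
    {i j : I} {x : X} (hi : x ∈ U i) (hj : x ∈ U j) :
    (hΦ.straighten hQ).val i j x
      = gram (polarFrame (Q x) (Φ i x)) (polarFrame (Q x) (Φ j x)) :=
  (hΦ.straighten hQ).val_of_mem ⟨hj, hi⟩

theorem FrameSystem.isExactCocycle_straighten (hΦ : FrameSystem ε U g Φ)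
    (hQ : NearbyProjection U Φ Q) : (hΦ.straighten hQ).IsExactCocycle := by
  intro i j k x hi hj hk
  rw [hΦ.straighten_val hQ hi hj, hΦ.straighten_val hQ hj hk, hΦ.straighten_val hQ hi hk,
    hΦ.gram_polarFrame_mul hQ hi hj]

/-- This makes the polar frames comparable, through `FrameSystem.homotopic` with `ε = 0`, with the
standard trivializations of the straightened cocycle. -/
theorem FrameSystem.frameSystem_polarFrame (hΦ : FrameSystem ε U g Φ)
    (hQ : NearbyProjection U Φ Q) :
    FrameSystem 0 U (hΦ.straighten hQ).val fun i x => polarFrame (Q x) (Φ i x) where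
  rows := hΦ.rows_polarFrame hQ
  cont := hΦ.continuousOn_polarFrame hQ
  orth _ _ hi := (hΦ.polarFrame_spec hQ hi).2.1
  trans_orth _ _ _ hi hj := (hΦ.straighten hQ).val_mul_transpose hi hj
  near i j x hi hj := by
    obtain ⟨n, hn⟩ := hΦ.rows_polarFrame hQ x
    refine Or.inl ⟨rfl, ?_⟩
    rw [hΦ.straighten_val hQ hi hj, mul_gram (hn.self_of_nhds i) (hn.self_of_nhds j)
      (hΦ.polarFrame_spec hQ hj).2.1 (hΦ.polarFrame_proj_eq hQ hi hj), sub_self, frobNorm_zero]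

/-- Every projection being averaged is already `Q x`. -/
theorem FrameSystem.av_polarFrame (hΦ : FrameSystem ε U g Φ) (hQ : NearbyProjection U Φ Q)
    {φ : PartitionOfUnity I X} (hφ : φ.IsSubordinate U) (x : X) :
    av φ (fun i x => polarFrame (Q x) (Φ i x)) x = Q x :=
  φ.finsum_smul_mem_convex (t := {Q x})
    (g := fun i x => polarFrame (Q x) (Φ i x) * (polarFrame (Q x) (Φ i x))ᵀ) (Set.mem_univ x)
    (fun i hi => (hΦ.polarFrame_spec hQ (hφ i (subset_tsupport _ hi))).2.2.1) (convex_singleton _)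

/-- The distance of the straightened cocycle from the original one. -/
theorem FrameSystem.frobNorm_sub_straighten_le (hΦ : FrameSystem ε U g Φ)
    (hQ : NearbyProjection U Φ Q) {i j : I} {x : X} (hi : x ∈ U i) (hj : x ∈ U j) :
    frobNorm (g i j x - (hΦ.straighten hQ).val i j x) ≤
      ε + frobNorm (Φ j x * (Φ j x)ᵀ - Q x) + frobNorm (Φ i x * (Φ i x)ᵀ - Q x) := by
  obtain ⟨n, hn⟩ := hΦ.rowsIn x
  have hΨ := fun i => (hQ.suppIn x n hn).rowsIn_polarFrame (Φ i x)
  rw [hΦ.straighten_val hQ hi hj]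
  refine (frobNorm_sub_gram_le (hn i) (hn j) (hΨ i) (hΨ j) (hΦ.orth i x hi)
    (hΦ.polarFrame_spec hQ hj).2.1 _).trans ?_
  exact add_le_add (add_le_add (hΦ.near i j x hi hj).le (hΦ.polarFrame_spec hQ hj).2.2.2)
    (hΦ.polarFrame_spec hQ hi).2.2.2

end Straighten

/-! ### Projecting the averaged map to the Grassmannian -/

section Projection

variable {X I : Type*} [TopologicalSpace X] {d : ℕ} {ε : ℝ} {U : I → Set X}
  {g : I → I → X → Matrix (Fin d) (Fin d) ℝ} {Φ : I → X → Matrix ℕ (Fin d) ℝ}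

theorem FrameSystem.frobDist_avMap (h : FrameSystem ε U g Φ) (hU : ∀ i, IsOpen (U i))
    {φ : PartitionOfUnity I X} (hφ : φ.IsSubordinate U) {x : X} {j : I} (hj : x ∈ U j)
    (hrow : ∃ n, RowsIn n (Φ j x)) :
    Near (√2 * ε) ((h.avMap hU hφ x).1.frobDist (frameProj (Φ j x) hrow)) :=
  h.near_av hφ hj

/-- Triangle inequality through the average: its closest point is at most as far from it as the
projection of `Φ j`, whence the factor `2`. -/
theorem FrameSystem.frobNorm_proj_sub_grProj_le (h : FrameSystem ε U g Φ)
    (hU : ∀ i, IsOpen (U i)) {φ : PartitionOfUnity I X} (hφ : φ.IsSubordinate U)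
    (hδ : √2 * ε ≤ 1 / 2) {x : X} {j : I} (hj : x ∈ U j) :
    frobNorm (Φ j x * (Φ j x)ᵀ - (grProj hδ (h.avMap hU hφ x)).1.entries)
      ≤ 2 * frobNorm (av φ Φ x - Φ j x * (Φ j x)ᵀ) := by
  have hrow := (h.rowsIn x).imp fun n (hn : ∀ i, RowsIn n (Φ i x)) => hn j
  have hGr := frameProj_mem_Gr hrow (h.orth j x hj)
  have h1 := (isClosestPointProjection_grProj hδ (h.avMap hU hφ x) _).2 rfl ⟨_, hGr⟩
  have h2 := InfMat.frobDist_triangle (frameProj (Φ j x) hrow) (h.avMap hU hφ x).1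
    (grProj hδ (h.avMap hU hφ x)).1
  rw [InfMat.frobDist_comm (frameProj (Φ j x) hrow) (h.avMap hU hφ x).1] at h2
  change frobNorm (Φ j x * (Φ j x)ᵀ - (grProj hδ (h.avMap hU hφ x)).1.entries) ≤
    2 * (h.avMap hU hφ x).1.frobDist (frameProj (Φ j x) hrow)
  exact h2.trans (by linarith [h1])

theorem FrameSystem.nearbyProjection_grProj (h : FrameSystem ε U g Φ)
    (hU : ∀ i, IsOpen (U i)) (hUc : ⋃ i, U i = Set.univ) {φ : PartitionOfUnity I X}
    (hφ : φ.IsSubordinate U) (hδ : √2 * ε ≤ 1 / 2) :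
    NearbyProjection U Φ fun x => (grProj hδ (h.avMap hU hφ x)).1.entries where
  continuous := InfMat.continuous_entries.comp (continuous_subtype_val.comp
    ((grProj hδ).continuous.comp (h.avMap hU hφ).continuous))
  suppIn x n hn := by
    obtain ⟨j, hj⟩ := Set.mem_iUnion.1 (hUc ▸ Set.mem_univ x)
    refine suppIn_closestPoint (P := frameProj (Φ j x) ⟨n, hn j⟩) (suppIn_av φ hn)
      (hn j).suppIn (frameProj_mem_Gr _ (h.orth j x hj)) ?_
    rcases h.frobDist_avMap hU hφ hj ⟨n, hn j⟩ with ⟨-, h1⟩ | ⟨-, h1⟩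
    · rw [h1]; norm_num
    · exact h1.trans_le hδ
  isProj x := mem_Gr_iff.1 (grProj hδ (h.avMap hU hφ x)).2
  -- The bound is `2 * (√2 * ε) ≤ 1`; strictness at the extreme value of `ε` comes from the strict
  -- inequality in `Near`.
  near j x hj := by
    refine (h.frobNorm_proj_sub_grProj_le hU hφ hδ hj).trans_lt ?_
    rcases h.near_av hφ hj with ⟨-, h1⟩ | ⟨-, h1⟩
    · rw [h1]; norm_num
    · linarith

/-- The thickening of radius `0` is the Grassmannian. -/
def thickGrZero (d : ℕ) : C(thickGr d (√2 * 0), Gr d) where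
  toFun A := ⟨A.1, by
    rcases A.2 with ⟨-, h⟩ | ⟨h, -⟩
    · exact h
    · simp at h⟩
  continuous_toFun := continuous_subtype_val.subtype_mk _

end Projection

end ApproxBundle

end

/-! ### The main theorem -/

theorem theorem4p19 {B : Type*} [TopologicalSpace B] [ParacompactSpace B] [NormalSpace B]
    {I : Type*} [Countable I] (U : I → Set B) (hUo : ∀ i, IsOpen (U i)) (hUc : ⋃ i, U i = Set.univ)
    (d : ℕ) (hd : 1 ≤ d) (ε : ℝ) (hε₀ : 0 ≤ ε) (hε : ε ≤ √2 / 4)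
    (Ω : ApproxBundle.Cochain U d) (hΩ : Ω.IsApproxCocycle ε) :
    ∃ π : C(ApproxBundle.thickGr d (√2 * ε), ApproxBundle.Gr d),
      ApproxBundle.IsClosestPointProjection π ∧
      ∃ clΩ : ApproxBundle.HomotopyClasses B (ApproxBundle.thickGr d (√2 * ε)),
        ApproxBundle.IsCl (ApproxBundle.thickGr d (√2 * ε)) Ω clΩ ∧
        ∃ (Λ : ApproxBundle.Cochain U d)
          (clΛ : ApproxBundle.HomotopyClasses B (ApproxBundle.Gr d)),
          Λ.IsExactCocycle ∧
          ApproxBundle.IsCl (ApproxBundle.Gr d) Λ clΛ ∧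
          clΛ = ApproxBundle.HomotopyClasses.postcomp π clΩ ∧
          ApproxBundle.cochainDist Ω Λ ≤ ENNReal.ofReal (9 * ε) := by
  have h2 : √2 * √2 = 2 := Real.mul_self_sqrt (by norm_num)
  have hδ : √2 * ε ≤ 1 / 2 := by nlinarith [Real.sqrt_nonneg 2]
  obtain ⟨φ₀, hφ₀⟩ := PartitionOfUnity.exists_isSubordinate isClosed_univ U hUo hUc.ge
  obtain ⟨ι, hι⟩ := exists_injective_nat I
  set ι₀ : I ↪ ℕ := ⟨ι, hι⟩
  have hsys := hΩ.frameSystem_triv hUo hφ₀ ι₀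
  set f₀ := hsys.avMap hUo hφ₀
  have hQ := hsys.nearbyProjection_grProj hUo hUc hφ₀ hδ
  have hexact := hsys.isExactCocycle_straighten hQ
  refine ⟨ApproxBundle.grProj hδ, ApproxBundle.isClosestPointProjection_grProj hδ,
    ApproxBundle.homotopyClass f₀, fun φ hφ ι => ?_, hsys.straighten hQ,
    ApproxBundle.homotopyClass ((ApproxBundle.grProj hδ).comp f₀), hexact, fun φ hφ ι => ?_, rfl,
    ?_⟩
  -- Every choice of `φ` and `ι` yields a frame system with the same transition functions `Ω.val`.
  · exact ⟨(hΩ.frameSystem_triv hUo hφ ι).avMap hUo hφ, fun _ => rfl, Quotient.sound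
      ((hΩ.frameSystem_triv hUo hφ ι).homotopic hsys hUo hφ hφ₀)⟩
  · have hΛ : (hsys.straighten hQ).IsApproxCocycle 0 := Or.inl ⟨rfl, hexact⟩
    have hpolar := hsys.frameSystem_polarFrame hQ
    refine ⟨(ApproxBundle.thickGrZero d).comp ((hΛ.frameSystem_triv hUo hφ ι).avMap hUo hφ),
      fun _ => rfl, Quotient.sound ?_⟩
    -- The projected average is itself the averaged map of the polar frames, whose transition
    -- functions are those of the new cocycle.
    have e : (ApproxBundle.grProj hδ).comp f₀
        = (ApproxBundle.thickGrZero d).comp (hpolar.avMap hUo hφ₀) := by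
      ext x
      exact ApproxBundle.InfMat.ext (hsys.av_polarFrame hQ hφ₀ x).symm
    change ContinuousMap.Homotopic _ _
    rw [e]
    exact (ContinuousMap.Homotopic.refl _).comp
      ((hΛ.frameSystem_triv hUo hφ ι).homotopic hpolar hUo hφ hφ₀)
  · refine iSup_le fun i => iSup_le fun j => iSup_le fun y => iSup_le fun hy =>
      ENNReal.ofReal_le_ofReal ?_
    have hdist : ∀ k, y ∈ U k → _ := fun k hk =>
      (hsys.frobNorm_proj_sub_grProj_le hUo hφ₀ hδ hk).trans
        (mul_le_mul_of_nonneg_left (hsys.near_av hφ₀ hk).le zero_le_two)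
    have h1 := hsys.frobNorm_sub_straighten_le hQ hy.2 hy.1
    have h3 := hdist i hy.2
    have h4 := hdist j hy.1
    -- The estimates add up to `ε + 4 * √2 * ε`; the crude bound `√2 ≤ 2` turns this into `9 * ε`.
    have h5 : √2 ≤ 2 := by nlinarith [Real.sqrt_nonneg 2]
    nlinarith
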